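/- Let $n\ge 2$, let $\mathcal H_{A}'$, $\mathcal H_{B}'$ be complex Hilbert spaces of arbitrary dimension, let $A_1',\dots,A_n'$ and $B_1',\dots,B_n'$ be $\pm1$-valued observables (bounded Hermitian operators with square $\mathbb 1$) on $\mathcal H_A'$ and $\mathcal H_B'$ respectively, and let $|\psi'\rangle\in\mathcal H_A'\otimes\mathcal H_B'$ be a unit vector. Suppose that they reach the maximal quantum value of the $n$-input chained Bell inequality: $$\langle\psi'|\sum_{i=1}^n\bigl(A_i'\otimes B_i'+A_{i+1}'\otimes B_i'\bigr)|\psi'\rangle=2n\cos\frac{\pi}{2n},\qquad A_{n+1}'=-A_1'.$$ Put $c=2\cos(\pi/2n)$ and $$X_A'=\begin{cases}A'_{n/2+1},& n \text{ even},\\ \bigl(A'_{(n+1)/2}+A'_{(n+3)/2}\bigr)/c,& n\text{ odd},\end{cases}\qquad Z_A'=A_1',$$ $$X_B'=\begin{cases}\bigl(B'_{n/2}+B'_{n/2+1}\bigr)/c,& n \text{ even},\\ B'_{(n+1)/2},& n\text{ odd},\end{cases}\qquad Z_B'=(B_1'-B_n')/c.$$ For a Hermitian operator $M$, let $P$ be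 the orthogonal projector onto $\ker M$ and let $\widetilde M=(M+P)/|M+P|$ be its regularization, i.e. the unique unitary with $M+P=\widetilde M\,|M+P|$, where $|T|=\sqrt{T^\dagger T}$; thus $\widetilde M=M$ if $M$ is already unitary. Let $\Phi$ be the swap circuit on $\mathcal H_A'\otimes\mathcal H_B'\otimes\mathbb C^2\otimes\mathbb C^2$ (the last two factors being ancilla qubits of $A$ and $B$) in which, for each party $C=A,B$, one applies successively a Hadamard gate to the ancilla of $C$, the gate $\widetilde Z_C$ controlled by that ancilla, a Hadamard gate to the ancilla, and the gate $\widetilde X_C$ controlled by the ancilla (a controlled gate acts when the ancilla is in the state $|1\rangle$). Then $\Phi$ is unitary, and there is a unit vector $|\varphi\rangle\in\mathcal H_A'\otimes\mathcal H_B'$ such that for all $i,j=1,\dots,n$ $$\Phi(|\psi'\rangle|00\rangle)=|\varphi\rangle|\phi_+\rangle,\qquad \Phi(A_i'|\psi'\rangle|00\rangle)=|\varphi\rangle A_i|\phi_+\rangle,$$ $$\Phi(B_j'|\psi'\rangle|00\rangle)=|\varphi\rangle B_j|\phi_+\rangle,\qquad \Phi(A_i'B_j'|\psi'\rangle|00\rangle)=|\varphi\rangle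 A_iB_j|\phi_+\rangle.$$ Here $|\phi_+\rangle=(|00\rangle+|11\rangle)/\sqrt2$ and, with the Pauli matrices $X,Z$, $A_i=\sin\phi_i\,X+\cos\phi_i\,Z$ acts on the first qubit and $B_j=\sin\phi_j'\,X+\cos\phi_j'\,Z$ on the second, where $\phi_i=(i-1)\pi/n$ and $\phi_j'=(2j-1)\pi/(2n)$. -/

import Mathlib

open scoped TensorProduct InnerProductSpace

noncomputable section

namespace ChainedBell

section Regularization

variable {H : Type*} [NormedAddCommGroup H] [InnerProductSpace ℂ H] [CompleteSpace H]

/-- `M + P`, where `P` is the orthogonal projector onto the kernel of `M`: the zero eigenvalue of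
a Hermitian operator `M`, if it occurs, is replaced by one. -/
def addKernelProj (M : H →L[ℂ] H) : H →L[ℂ] H :=
  M + (LinearMap.ker M.toLinearMap).starProjection

/-- `U` is the unitary polar factor `(M + P) / |M + P|` of `M + P`, that is, `U` is unitary and
`M + P = U |M + P|` with `|T| = √(T† T)`. -/
def IsRegularization (M U : H →L[ℂ] H) : Prop :=
  U ∈ unitary (H →L[ℂ] H) ∧ addKernelProj M = U * CFC.abs (addKernelProj M)

/-- The regularized version `(M + P) / |M + P|` of a Hermitian operator `M`. -/
def regularization (M : H →L[ℂ] H) : H →L[ℂ] H :=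
  Classical.epsilon (IsRegularization M)

theorem isSelfAdjoint_addKernelProj {M : H →L[ℂ] H} (hM : IsSelfAdjoint M) :
    IsSelfAdjoint (addKernelProj M) :=
  hM.add (isSelfAdjoint_starProjection _)

theorem ker_addKernelProj {M : H →L[ℂ] H} (hM : IsSelfAdjoint M) (x : H)
    (hx : addKernelProj M x = 0) : x = 0 := by
  set P := (LinearMap.ker M.toLinearMap).starProjection with hP
  have hPx : M (P x) = 0 := by
    exact LinearMap.mem_ker.1
      (Submodule.starProjection_apply_mem (LinearMap.ker M.toLinearMap) x)
  have h0 : M x + P x = 0 := by simpa [addKernelProj] using hx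
  have h1 : ⟪M x, P x⟫_ℂ = 0 := by
    have := ContinuousLinearMap.adjoint_inner_right M x (P x)
    rw [← this, hM.adjoint_eq, hPx, inner_zero_right]
  have h2 : P x = 0 := by
    have h3 : M x = -P x := eq_neg_of_add_eq_zero_left h0
    rw [h3, inner_neg_left, neg_eq_zero, inner_self_eq_zero] at h1
    exact h1
  have h4 : x ∈ LinearMap.ker M.toLinearMap := by
    rw [h2, add_zero] at h0
    simpa using h0
  have h5 : P x = x := Submodule.starProjection_eq_self_iff.2 h4
  rw [← h5, h2]

theorem denseRange_of_injective {T : H →L[ℂ] H} (hT : IsSelfAdjoint T)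
    (h : ∀ x, T x = 0 → x = 0) : DenseRange T := by
  have h1 : T.rangeᗮ = ⊥ := by
    rw [T.orthogonal_range, hT.adjoint_eq]
    exact (Submodule.eq_bot_iff _).2 fun x hx => h x (by simpa using hx)
  have h2 := (Submodule.topologicalClosure_eq_top_iff (K := T.range)).2 h1
  have h3 := (Submodule.dense_iff_topologicalClosure_eq_top (s := T.range)).2 h2
  rwa [LinearMap.coe_range] at h3

theorem norm_cfcAbs_apply (T : H →L[ℂ] H) (x : H) : ‖CFC.abs T x‖ = ‖T x‖ := by
  have h1 : ⟪CFC.abs T x, CFC.abs T x⟫_ℂ = ⟪T x, T x⟫_ℂ := by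
    have hs : IsSelfAdjoint (CFC.abs T) := IsSelfAdjoint.of_nonneg (CFC.abs_nonneg T)
    rw [← ContinuousLinearMap.adjoint_inner_right (CFC.abs T), hs.adjoint_eq,
      ← ContinuousLinearMap.adjoint_inner_right T]
    have := congrArg (fun S : H →L[ℂ] H => S x) (CFC.abs_mul_abs T)
    simp only [mul_apply_eq_comp, ContinuousLinearMap.star_eq_adjoint] at this
    rw [this]
  rw [inner_self_eq_norm_sq_to_K, inner_self_eq_norm_sq_to_K] at h1
  have h2 : ‖CFC.abs T x‖ ^ 2 = ‖T x‖ ^ 2 := by exact_mod_cast h1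
  exact (sq_eq_sq₀ (norm_nonneg _) (norm_nonneg _)).1 h2

/-- A Hermitian operator has exactly one regularization. -/
theorem existsUnique_isRegularization {M : H →L[ℂ] H} (hM : IsSelfAdjoint M) :
    ∃! U, IsRegularization M U := by
  set T := addKernelProj M with hTdef
  have hT : IsSelfAdjoint T := isSelfAdjoint_addKernelProj hM
  have hinj : ∀ x, T x = 0 → x = 0 := ker_addKernelProj hM
  set R := CFC.abs T with hR
  have hRs : IsSelfAdjoint R := IsSelfAdjoint.of_nonneg (CFC.abs_nonneg T)
  have hnorm : ∀ x, ‖R x‖ = ‖T x‖ := norm_cfcAbs_apply T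
  have hRinj : ∀ x, R x = 0 → x = 0 := fun x hx => hinj x (by
    rw [← norm_eq_zero, ← hnorm, hx, norm_zero])
  have hTd : DenseRange T := denseRange_of_injective hT hinj
  have hRd : DenseRange R := denseRange_of_injective hRs hRinj
  set U := T.toLinearMap.extendOfNorm R.toLinearMap with hU
  set V := R.toLinearMap.extendOfNorm T.toLinearMap with hV
  have hUR : ∀ x, U (R x) = T x := fun x =>
    LinearMap.extendOfNorm_eq (f := T.toLinearMap) (e := R.toLinearMap) hRd
      ⟨1, fun y => by simp [hnorm]⟩ x
  have hVT : ∀ x, V (T x) = R x := fun x =>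
    LinearMap.extendOfNorm_eq (f := R.toLinearMap) (e := T.toLinearMap) hTd
      ⟨1, fun y => by simp [hnorm]⟩ x
  have hUnorm : ∀ y, ‖U y‖ = ‖y‖ := fun y => by
    have : (fun y => ‖U y‖) = fun y => ‖y‖ :=
      hRd.equalizer (by fun_prop) (by fun_prop) (by
        funext x
        simp [hUR, hnorm])
    exact congrFun this y
  have hUV : U * V = 1 := by
    refine ContinuousLinearMap.ext fun y => ?_
    have : (fun y => U (V y)) = fun y => y :=
      hTd.equalizer (by fun_prop) (by fun_prop) (by
        funext x
        simp [hUR, hVT])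
    exact congrFun this y
  have hUU : star U * U = 1 :=
    (ContinuousLinearMap.norm_map_iff_adjoint_comp_self U).1 hUnorm
  have hVU : star U = V := left_inv_eq_right_inv hUU hUV
  refine ⟨U, ⟨Unitary.mem_iff.2 ⟨hUU, by rw [hVU, hUV]⟩, ?_⟩, ?_⟩
  · exact ContinuousLinearMap.ext fun x => (hUR x).symm
  · rintro W ⟨-, hW⟩
    refine ContinuousLinearMap.ext fun y => ?_
    have : (fun y => W y) = fun y => U y :=
      hRd.equalizer (by fun_prop) (by fun_prop) (by
        funext x
        have h := congrArg (fun S : H →L[ℂ] H => S x) hW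
        simp only [Function.comp_apply, hUR]
        exact h.symm)
    exact congrFun this y

theorem isRegularization_regularization {M : H →L[ℂ] H} (hM : IsSelfAdjoint M) :
    IsRegularization M (regularization M) :=
  Classical.epsilon_spec (existsUnique_isRegularization hM).exists

/-- An operator that is already Hermitian and unitary is left unchanged. -/
theorem regularization_of_unitary {M : H →L[ℂ] H} (hM : IsSelfAdjoint M) (hM2 : M * M = 1) :
    regularization M = M := by
  refine (existsUnique_isRegularization hM).unique (isRegularization_regularization hM) ?_
  have hk : LinearMap.ker M.toLinearMap = ⊥ := (Submodule.eq_bot_iff _).2 fun x hx => by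
    have h := congrArg (fun S : H →L[ℂ] H => S x) hM2
    have hx' : M x = 0 := by simpa using hx
    simpa [hx'] using h.symm
  have hP : addKernelProj M = M := by simp [addKernelProj, hk]
  refine ⟨Unitary.mem_iff.2 ⟨by rw [hM.star_eq, hM2], by rw [hM.star_eq, hM2]⟩, ?_⟩
  rw [hP, CFC.abs, hM.star_eq, hM2, CFC.sqrt_one, mul_one]

end Regularization

/-! ### The physical experiment -/

/-- The Hilbert space tensor product of `HA` and `HB`. -/
abbrev JointSpace (HA HB : Type*) [NormedAddCommGroup HA] [InnerProductSpace ℂ HA]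
    [NormedAddCommGroup HB] [InnerProductSpace ℂ HB] : Type _ :=
  UniformSpace.Completion (HA ⊗[ℂ] HB)

/-- A `±1`-valued observable: a Hermitian operator with square one. -/
def IsObservable {H : Type*} [NormedAddCommGroup H] [InnerProductSpace ℂ H] [CompleteSpace H]
    (C : H →L[ℂ] H) : Prop :=
  IsSelfAdjoint C ∧ C * C = 1

section Physical

variable {HA HB : Type*} [NormedAddCommGroup HA] [InnerProductSpace ℂ HA]
  [NormedAddCommGroup HB] [InnerProductSpace ℂ HB]

/-- The operator `S ⊗ T` on the Hilbert space tensor product. -/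
def tensorOp (S : HA →L[ℂ] HA) (T : HB →L[ℂ] HB) : JointSpace HA HB →L[ℂ] JointSpace HA HB :=
  (TensorProduct.mapL S T).completion

/-- The operators `C 1, …, C n`, continued by `C (n + 1) = -C 1`. -/
def next {H : Type*} [NormedAddCommGroup H] [InnerProductSpace ℂ H] (n : ℕ)
    (C : ℕ → H →L[ℂ] H) (k : ℕ) : H →L[ℂ] H :=
  if k = n + 1 then -C 1 else C k

/-- The Bell operator `∑ᵢ (Aᵢ ⊗ Bᵢ + Aᵢ₊₁ ⊗ Bᵢ)`, `i = 1, …, n`, with `Aₙ₊₁ = -A₁`, of the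
chained Bell inequality. -/
def bellOperator (n : ℕ) (A : ℕ → HA →L[ℂ] HA) (B : ℕ → HB →L[ℂ] HB) :
    JointSpace HA HB →L[ℂ] JointSpace HA HB :=
  ∑ i ∈ Finset.Icc 1 n, (tensorOp (A i) (B i) + tensorOp (next n A (i + 1)) (B i))

/-- `1 / (2 cos (π / 2n))`. -/
def scale (n : ℕ) : ℂ := ((1 / (2 * Real.cos (Real.pi / (2 * n))) : ℝ) : ℂ)

/-- The operator `X_A'`. -/
def opXA (n : ℕ) (A : ℕ → HA →L[ℂ] HA) : HA →L[ℂ] HA :=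
  if Even n then A (n / 2 + 1) else scale n • (A ((n + 1) / 2) + A ((n + 3) / 2))

/-- The operator `Z_A'`. -/
def opZA (A : ℕ → HA →L[ℂ] HA) : HA →L[ℂ] HA := A 1

/-- The operator `X_B'`. -/
def opXB (n : ℕ) (B : ℕ → HB →L[ℂ] HB) : HB →L[ℂ] HB :=
  if Even n then scale n • (B (n / 2) + B (n / 2 + 1)) else B ((n + 1) / 2)

/-- The operator `Z_B'`. -/
def opZB (n : ℕ) (B : ℕ → HB →L[ℂ] HB) : HB →L[ℂ] HB := scale n • (B 1 - B n)

end Physical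

/-! ### Qubits and the reference experiment -/

abbrev Qubit : Type := EuclideanSpace ℂ (Fin 2)

/-- The computational basis vectors `|0⟩`, `|1⟩`. -/
def ket (k : Fin 2) : Qubit := EuclideanSpace.single k 1

def pauliX : Qubit →L[ℂ] Qubit := Matrix.toEuclideanCLM (𝕜 := ℂ) !![0, 1; 1, 0]

def pauliZ : Qubit →L[ℂ] Qubit := Matrix.toEuclideanCLM (𝕜 := ℂ) !![1, 0; 0, -1]

def hadamard : Qubit →L[ℂ] Qubit :=
  ((1 / √2 : ℝ) : ℂ) • Matrix.toEuclideanCLM (𝕜 := ℂ) !![1, 1; 1, -1]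

/-- The projectors `|0⟩⟨0|` and `|1⟩⟨1|`. -/
def proj0 : Qubit →L[ℂ] Qubit := Matrix.toEuclideanCLM (𝕜 := ℂ) !![1, 0; 0, 0]

def proj1 : Qubit →L[ℂ] Qubit := Matrix.toEuclideanCLM (𝕜 := ℂ) !![0, 0; 0, 1]

/-- The maximally entangled state `|φ₊⟩ = (|00⟩ + |11⟩) / √2`. -/
def phiPlus : Qubit ⊗[ℂ] Qubit :=
  ((1 / √2 : ℝ) : ℂ) • (ket 0 ⊗ₜ[ℂ] ket 0 + ket 1 ⊗ₜ[ℂ] ket 1)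

/-- The measurement `sin θ X + cos θ Z` in the `XZ` plane. -/
def planar (θ : ℝ) : Qubit →L[ℂ] Qubit :=
  ((Real.sin θ : ℝ) : ℂ) • pauliX + ((Real.cos θ : ℝ) : ℂ) • pauliZ

/-- Alice's reference measurements, at the angles `(i - 1)π / n`. -/
def refA (n i : ℕ) : Qubit →L[ℂ] Qubit := planar (((i : ℝ) - 1) * Real.pi / n)

/-- Bob's reference measurements, at the angles `(2i - 1)π / 2n`. -/
def refB (n i : ℕ) : Qubit →L[ℂ] Qubit := planar ((2 * (i : ℝ) - 1) * Real.pi / (2 * n))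

/-! ### The swap circuit

It acts on `(HA ⊗ HB) ⊗ (ℂ² ⊗ ℂ²)`; the last two factors are Alice's and Bob's ancilla qubits.
The algebraic tensor product with the finite-dimensional space of the ancillas is already complete.
-/

section Circuit

variable {HA HB : Type*} [NormedAddCommGroup HA] [InnerProductSpace ℂ HA]
  [NormedAddCommGroup HB] [InnerProductSpace ℂ HB]

abbrev CircuitSpace (HA HB : Type*) [NormedAddCommGroup HA] [InnerProductSpace ℂ HA]
    [NormedAddCommGroup HB] [InnerProductSpace ℂ HB] : Type _ :=
  JointSpace HA HB ⊗[ℂ] (Qubit ⊗[ℂ] Qubit)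

/-- A one-qubit gate on Alice's ancilla. -/
def gateA (g : Qubit →L[ℂ] Qubit) : CircuitSpace HA HB →L[ℂ] CircuitSpace HA HB :=
  TensorProduct.mapL 1 (TensorProduct.mapL g 1)

/-- A one-qubit gate on Bob's ancilla. -/
def gateB (g : Qubit →L[ℂ] Qubit) : CircuitSpace HA HB →L[ℂ] CircuitSpace HA HB :=
  TensorProduct.mapL 1 (TensorProduct.mapL 1 g)

/-- `U` on Alice's system, controlled by her ancilla. -/
def controlledA (U : HA →L[ℂ] HA) : CircuitSpace HA HB →L[ℂ] CircuitSpace HA HB :=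
  TensorProduct.mapL 1 (TensorProduct.mapL proj0 1) +
    TensorProduct.mapL (tensorOp U 1) (TensorProduct.mapL proj1 1)

/-- `U` on Bob's system, controlled by his ancilla. -/
def controlledB (U : HB →L[ℂ] HB) : CircuitSpace HA HB →L[ℂ] CircuitSpace HA HB :=
  TensorProduct.mapL 1 (TensorProduct.mapL 1 proj0) +
    TensorProduct.mapL (tensorOp 1 U) (TensorProduct.mapL 1 proj1)

/-- Alice's half of the swap circuit: Hadamard, controlled `Z`, Hadamard, controlled `X`. -/
def circuitA (X Z : HA →L[ℂ] HA) : CircuitSpace HA HB →L[ℂ] CircuitSpace HA HB :=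
  controlledA X ∘L gateA hadamard ∘L controlledA Z ∘L gateA hadamard

/-- Bob's half of the swap circuit. -/
def circuitB (X Z : HB →L[ℂ] HB) : CircuitSpace HA HB →L[ℂ] CircuitSpace HA HB :=
  controlledB X ∘L gateB hadamard ∘L controlledB Z ∘L gateB hadamard

/-- The swap circuit `Φ` built from the observables `A 1, …, A n` and `B 1, …, B n`. -/
def swapCircuit [CompleteSpace HA] [CompleteSpace HB] (n : ℕ)
    (A : ℕ → HA →L[ℂ] HA) (B : ℕ → HB →L[ℂ] HB) :
    CircuitSpace HA HB →L[ℂ] CircuitSpace HA HB :=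
  circuitA (regularization (opXA n A)) (regularization (opZA A)) ∘L
    circuitB (regularization (opXB n B)) (regularization (opZB n B))

end Circuit

end ChainedBell

end

open ChainedBell

noncomputable section

namespace ChainedBell

/-! The vectors A₁ψ, B₁ψ, A₂ψ, …, Bₙψ, −A₁ψ form a chain v₀, …, v_N = −v₀ with N = 2n steps between
unit vectors, and the Bell value is the sum of the real parts of consecutive inner products. In
`planar_of_sum_inner_eq` the defect 2(N cos(π/N) − ∑⟨v_k, v_{k+1}⟩) is a positive combination of
squared norms. At the maximum all of them vanish, which forces the chain to be a regular half-turn: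
every Aᵢψ and Bⱼψ is cos · e + sin · f at its reference angle, with e = A₁ψ
(`exists_planar_of_maximal`).

Hence Zψ = e and Xψ = f for both parties. An operator acting on ψ can therefore be traded for the
other party's and commuted past everything on its own side. This gives X²ψ = Z²ψ = ψ, and expanding
B₁²ψ = ψ in e and f leaves ZXψ = −XZψ (`isSwapFrame_of_planar`). Regularization does not change the
action of M on a vector fixed by M² (`map_regularization_apply`), so the gates of the circuit
satisfy the same relations on ψ.

These relations determine the circuit on the span of ψ, Zψ, Xψ, XZψ: the four vectors go to one
common vector tensored with the four Bell vectors (`IsSwapFrame.circuit_apply`). The states ψ, Aᵢψ,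
Bⱼψ, AᵢBⱼψ have the same coefficients in this span as the reference states have in the Bell vectors.
Unitarity is independent of the violation: every gate has a formal adjoint that inverts it. -/

/-- `S` is a formal adjoint of `T`, with no completeness assumption on the space. -/
def IsFormalAdjoint {E : Type*} [NormedAddCommGroup E] [InnerProductSpace ℂ E]
    (T S : E →L[ℂ] E) : Prop :=
  ∀ x y, ⟪T x, y⟫_ℂ = ⟪x, S y⟫_ℂ

/-! ### Adjoints and unitarity without completeness -/

section FormalAdjoint

variable {E F : Type*} [NormedAddCommGroup E] [InnerProductSpace ℂ E]
  [NormedAddCommGroup F] [InnerProductSpace ℂ F]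

theorem IsFormalAdjoint.one : IsFormalAdjoint (1 : E →L[ℂ] E) 1 := fun _ _ => rfl

theorem IsFormalAdjoint.add {T S T' S' : E →L[ℂ] E} (h : IsFormalAdjoint T S)
    (h' : IsFormalAdjoint T' S') : IsFormalAdjoint (T + T') (S + S') := fun x y => by
  rw [add_apply, add_apply, inner_add_left, inner_add_right, h x y, h' x y]

theorem isFormalAdjoint_star [CompleteSpace E] (T : E →L[ℂ] E) : IsFormalAdjoint T (star T) :=
  fun x y => (ContinuousLinearMap.adjoint_inner_right T x y).symm

theorem IsFormalAdjoint.star_eq [CompleteSpace E] {T S : E →L[ℂ] E} (h : IsFormalAdjoint T S) :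
    star T = S := by
  refine ContinuousLinearMap.ext fun y => ext_inner_left ℂ fun x => ?_
  rw [← h x y, isFormalAdjoint_star T x y]

theorem IsFormalAdjoint.mapL {T S : E →L[ℂ] E} {T' S' : F →L[ℂ] F} (h : IsFormalAdjoint T S)
    (h' : IsFormalAdjoint T' S') :
    IsFormalAdjoint (TensorProduct.mapL T T') (TensorProduct.mapL S S') := fun x y => by
  induction x using TensorProduct.induction_on with
  | zero => simp
  | add x₁ x₂ h₁ h₂ => rw [map_add, inner_add_left, inner_add_left, h₁, h₂]
  | tmul a b =>
    induction y using TensorProduct.induction_on with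
    | zero => simp
    | add y₁ y₂ h₁ h₂ => rw [map_add, inner_add_right, inner_add_right, h₁, h₂]
    | tmul c d =>
      simp only [TensorProduct.mapL_tmul, TensorProduct.inner_tmul, h a c, h' b d]

theorem IsFormalAdjoint.completion {T S : E →L[ℂ] E} (h : IsFormalAdjoint T S) :
    IsFormalAdjoint T.completion S.completion := fun x y => by
  induction x, y using UniformSpace.Completion.induction_on₂ with
  | hp =>
    exact isClosed_eq (by fun_prop) (by fun_prop)
  | ih a b =>
    simp only [ContinuousLinearMap.completion_apply_coe, UniformSpace.Completion.inner_coe, h a b]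

/-- An operator with a formal adjoint that inverts it on both sides is a surjective isometry. -/
theorem IsFormalAdjoint.exists_linearIsometryEquiv {T S : E →L[ℂ] E} (h : IsFormalAdjoint T S)
    (hST : S * T = 1) (hTS : T * S = 1) : ∃ U : E ≃ₗᵢ[ℂ] E, ∀ v, U v = T v := by
  have h₁ : ∀ x, S (T x) = x := fun x => congrArg (fun R : E →L[ℂ] E => R x) hST
  have h₂ : ∀ x, T (S x) = x := fun x => congrArg (fun R : E →L[ℂ] E => R x) hTS
  refine ⟨⟨LinearEquiv.ofLinearMap T.toLinearMap S.toLinearMap (LinearMap.ext h₂)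
    (LinearMap.ext h₁), fun x => ?_⟩, fun v => rfl⟩
  have h₃ : ⟪T x, T x⟫_ℂ = ⟪x, x⟫_ℂ := by rw [h x, h₁]
  rw [inner_self_eq_norm_sq_to_K, inner_self_eq_norm_sq_to_K] at h₃
  have h₄ : ‖T x‖ ^ 2 = ‖x‖ ^ 2 := by exact_mod_cast h₃
  exact (sq_eq_sq₀ (norm_nonneg _) (norm_nonneg _)).1 h₄

end FormalAdjoint

/-! ### Commuting representations of the two parties on the joint space -/

section TensorOp

variable {HA HB : Type*} [NormedAddCommGroup HA] [InnerProductSpace ℂ HA]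
  [NormedAddCommGroup HB] [InnerProductSpace ℂ HB]

theorem tensorOp_coe_tmul (S : HA →L[ℂ] HA) (T : HB →L[ℂ] HB) (x : HA) (y : HB) :
    tensorOp S T ((x ⊗ₜ[ℂ] y : HA ⊗[ℂ] HB) : JointSpace HA HB) =
      ((S x ⊗ₜ[ℂ] T y : HA ⊗[ℂ] HB) : JointSpace HA HB) := by
  rw [tensorOp, ContinuousLinearMap.completion_apply_coe, TensorProduct.mapL_tmul]

/-- Elementary tensors span a dense subspace, so operator identities on the completion can be
checked on them. -/
theorem jointSpace_ext {S T : JointSpace HA HB →L[ℂ] JointSpace HA HB}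
    (h : ∀ x y, S ((x ⊗ₜ[ℂ] y : HA ⊗[ℂ] HB) : JointSpace HA HB) =
      T ((x ⊗ₜ[ℂ] y : HA ⊗[ℂ] HB) : JointSpace HA HB)) : S = T := by
  refine ContinuousLinearMap.ext fun v => ?_
  induction v using UniformSpace.Completion.induction_on with
  | hp => exact isClosed_eq (by fun_prop) (by fun_prop)
  | ih a =>
    induction a using TensorProduct.induction_on with
    | zero => rw [UniformSpace.Completion.coe_zero, map_zero, map_zero]
    | add x y hx hy => rw [UniformSpace.Completion.coe_add, map_add, map_add, hx, hy]
    | tmul x y => exact h x y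

theorem tensorOp_mul (S S' : HA →L[ℂ] HA) (T T' : HB →L[ℂ] HB) :
    tensorOp (S * S') (T * T') = tensorOp S T * tensorOp S' T' :=
  jointSpace_ext fun x y => by simp [tensorOp_coe_tmul]

theorem tensorOp_one : tensorOp (1 : HA →L[ℂ] HA) (1 : HB →L[ℂ] HB) = 1 :=
  jointSpace_ext fun x y => by simp [tensorOp_coe_tmul]

theorem isFormalAdjoint_tensorOp [CompleteSpace HA] [CompleteSpace HB]
    (S : HA →L[ℂ] HA) (T : HB →L[ℂ] HB) :
    IsFormalAdjoint (tensorOp S T) (tensorOp (star S) (star T)) :=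
  ((isFormalAdjoint_star S).mapL (isFormalAdjoint_star T)).completion

/-- Operators on Alice's system, acting on the joint system. -/
def leftRep (HA HB : Type*) [NormedAddCommGroup HA] [InnerProductSpace ℂ HA]
    [NormedAddCommGroup HB] [InnerProductSpace ℂ HB] [CompleteSpace HA] [CompleteSpace HB] :
    (HA →L[ℂ] HA) →⋆ₐ[ℂ] (JointSpace HA HB →L[ℂ] JointSpace HA HB) where
  toFun S := tensorOp S 1
  map_one' := tensorOp_one
  map_mul' S T := by rw [← tensorOp_mul, one_mul]
  map_zero' := jointSpace_ext fun x y => by simp [tensorOp_coe_tmul]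
  map_add' S T := jointSpace_ext fun x y => by simp [tensorOp_coe_tmul, TensorProduct.add_tmul,
    UniformSpace.Completion.coe_add]
  commutes' r := jointSpace_ext fun x y => by
    simp [tensorOp_coe_tmul, Algebra.algebraMap_eq_smul_one, ← TensorProduct.smul_tmul',
      UniformSpace.Completion.coe_smul]
  map_star' S := by
    have h := (isFormalAdjoint_tensorOp S (1 : HB →L[ℂ] HB)).star_eq
    rw [star_one] at h
    exact h.symm

/-- Operators on Bob's system, acting on the joint system. -/
def rightRep (HA HB : Type*) [NormedAddCommGroup HA] [InnerProductSpace ℂ HA]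
    [NormedAddCommGroup HB] [InnerProductSpace ℂ HB] [CompleteSpace HA] [CompleteSpace HB] :
    (HB →L[ℂ] HB) →⋆ₐ[ℂ] (JointSpace HA HB →L[ℂ] JointSpace HA HB) where
  toFun T := tensorOp 1 T
  map_one' := tensorOp_one
  map_mul' S T := by rw [← tensorOp_mul, one_mul]
  map_zero' := jointSpace_ext fun x y => by simp [tensorOp_coe_tmul]
  map_add' S T := jointSpace_ext fun x y => by simp [tensorOp_coe_tmul, TensorProduct.tmul_add,
    UniformSpace.Completion.coe_add]
  commutes' r := jointSpace_ext fun x y => by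
    simp [tensorOp_coe_tmul, Algebra.algebraMap_eq_smul_one,
      UniformSpace.Completion.coe_smul]
  map_star' S := by
    have h := (isFormalAdjoint_tensorOp (1 : HA →L[ℂ] HA) S).star_eq
    rw [star_one] at h
    exact h.symm

variable [CompleteSpace HA] [CompleteSpace HB]

theorem tensorOp_apply_eq (S : HA →L[ℂ] HA) (T : HB →L[ℂ] HB) (v : JointSpace HA HB) :
    tensorOp S T v = leftRep HA HB S (rightRep HA HB T v) := by
  have h := tensorOp_mul S 1 1 T
  rw [mul_one, one_mul] at h
  rw [h]
  rfl

/-- Used throughout as a rewriting rule that moves Bob's operators inward until they meet the state.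
-/
theorem rightRep_leftRep_apply (S : HA →L[ℂ] HA) (T : HB →L[ℂ] HB) (v : JointSpace HA HB) :
    rightRep HA HB T (leftRep HA HB S v) = leftRep HA HB S (rightRep HA HB T v) := by
  have h := tensorOp_mul 1 S T 1
  rw [mul_one, one_mul] at h
  rw [← tensorOp_apply_eq, h]
  rfl

end TensorOp

/-! ### Regularization on vectors fixed by the square -/

section RegularizationAction

variable {H K : Type*} [NormedAddCommGroup H] [InnerProductSpace ℂ H] [CompleteSpace H]
  [NormedAddCommGroup K] [InnerProductSpace ℂ K] [CompleteSpace K]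

/-- If `T² v = v` in a representation then `|T| v = v` for Hermitian `T`. -/
theorem map_abs_apply_of_sq (π : (H →L[ℂ] H) →⋆ₐ[ℂ] (K →L[ℂ] K)) {T : H →L[ℂ] H}
    (hT : IsSelfAdjoint T) {v : K} (hv : π T (π T v) = v) : π (CFC.abs T) v = v := by
  set R := CFC.abs T with hR
  have hRR : π R (π R v) = v := by
    have h : R * R = T * T := by rw [hR, CFC.abs_mul_abs, hT.star_eq]
    have h' := congrArg (fun S : K →L[ℂ] K => S v) (congrArg π h)
    simp only [map_mul, mul_apply_eq_comp] at h'
    rw [h', hv]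
  -- The defect w satisfies |T| w = −w, which positivity forbids unless w = 0: ⟨w, |T| w⟩ is the
  -- squared norm of √|T| w.
  set w := π R v - v with hw
  have hRw : π R w = -w := by rw [hw, map_sub, hRR]; abel
  set Q := CFC.sqrt R with hQ
  have hQs : star (π Q) = π Q := by
    rw [← map_star, (IsSelfAdjoint.of_nonneg (CFC.sqrt_nonneg R)).star_eq]
  have hQQ : Q * Q = R := CFC.sqrt_mul_sqrt_self R (CFC.abs_nonneg T)
  have h₁ : ⟪π Q w, π Q w⟫_ℂ = ⟪w, -w⟫_ℂ := by
    rw [isFormalAdjoint_star (π Q), hQs, ← hRw, ← hQQ, map_mul, mul_apply_eq_comp]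
  rw [inner_neg_right, inner_self_eq_norm_sq_to_K, inner_self_eq_norm_sq_to_K] at h₁
  have h₂ : ‖π Q w‖ ^ 2 = -‖w‖ ^ 2 := by exact_mod_cast h₁
  have h₃ : ‖w‖ = 0 := by
    have := sq_nonneg ‖π Q w‖
    have := sq_nonneg ‖w‖
    exact pow_eq_zero_iff two_ne_zero |>.1 (by linarith)
  exact sub_eq_zero.1 (norm_eq_zero.1 h₃)

/-- The regularization acts as the operator itself on vectors fixed by its square. -/
theorem map_regularization_apply (π : (H →L[ℂ] H) →⋆ₐ[ℂ] (K →L[ℂ] K)) {M : H →L[ℂ] H}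
    (hM : IsSelfAdjoint M) {v : K} (hv : π M (π M v) = v) :
    π (regularization M) v = π M v := by
  set P := (LinearMap.ker M.toLinearMap).starProjection with hP
  have hMP : M * P = 0 := ContinuousLinearMap.ext fun x => LinearMap.mem_ker.1
    (Submodule.starProjection_apply_mem (LinearMap.ker M.toLinearMap) x)
  have hPM : P * M = 0 := by
    have h := congrArg star hMP
    rwa [star_mul, hM.star_eq, (isSelfAdjoint_starProjection _).star_eq, star_zero] at h
  -- The kernel projector kills the range of M, and v = M(Mv) lies in that range, so adding P
  -- changes nothing on v or Mv.
  have hPv : ∀ u, π P (π M u) = 0 := fun u => by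
    rw [← mul_apply_eq_comp, ← map_mul, hPM, map_zero, zero_apply]
  have hT : ∀ u, π (addKernelProj M) (π M u) = π M (π M u) := fun u => by
    rw [addKernelProj, map_add, add_apply, hPv, add_zero]
  have hTv : π (addKernelProj M) v = π M v := by
    have h := hT (π M v)
    rwa [hv] at h
  have habs := map_abs_apply_of_sq π (isSelfAdjoint_addKernelProj hM) (v := v)
    (by rw [hTv, hT, hv])
  have h := congrArg (fun S : K →L[ℂ] K => S v)
    (congrArg π (isRegularization_regularization hM).2)
  simp only [map_mul, mul_apply_eq_comp] at h
  rw [← hTv, h, habs]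

end RegularizationAction

/-! ### Rigidity of a maximal chain of unit vectors -/

section Rigidity

/-- Unit vectors `v₀, …, v_N = -v₀` whose consecutive inner products add up to the maximal value
`N cos (π / N)` form a regular half-turn in a plane. -/
theorem planar_of_sum_inner_eq {F : Type*} [NormedAddCommGroup F] [InnerProductSpace ℝ F]
    {N : ℕ} (hN : 3 ≤ N) (v : ℕ → F) (hv : ∀ k < N, ‖v k‖ = 1) (hvN : v N = -v 0)
    (hsum : ∑ k ∈ Finset.range N, ⟪v k, v (k + 1)⟫_ℝ = N * Real.cos (Real.pi / N)) :
    ∃ w : F, ∀ k < N, v k =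
      Real.cos (k * (Real.pi / N)) • v 0 + Real.sin (k * (Real.pi / N)) • w := by
  obtain ⟨m, rfl⟩ : ∃ m, N = m + 2 := ⟨N - 2, by omega⟩
  set θ : ℝ := Real.pi / ((m + 2 : ℕ) : ℝ) with hθ
  have hNθ : ((m : ℝ) + 2) * θ = Real.pi := by
    rw [hθ]; push_cast; field_simp
  have hθ0 : 0 < θ := by positivity
  have hs : ∀ k : ℕ, k < m + 1 → 0 < Real.sin ((k + 1) * θ) := fun k hk => by
    refine Real.sin_pos_of_pos_of_lt_pi (by positivity) ?_
    rw [← hNθ]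
    have : (k : ℝ) + 1 < m + 2 := by exact_mod_cast (by omega : k + 1 < m + 2)
    gcongr
  have hs1 : 0 < Real.sin θ := by simpa using hs 0 (by omega)
  have hss : ∀ k : ℕ, Real.sin ((k + 1 + 1) * θ) =
      Real.sin ((k + 1) * θ) * Real.cos θ + Real.cos ((k + 1) * θ) * Real.sin θ := fun k => by
    rw [← Real.sin_add]; ring_nf
  have hcs : ∀ k : ℕ, Real.cos ((k + 1 + 1) * θ) =
      Real.cos ((k + 1) * θ) * Real.cos θ - Real.sin ((k + 1) * θ) * Real.sin θ := fun k => by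
    rw [← Real.cos_add]; ring_nf
  set s : ℕ → ℝ := fun k => Real.sin ((k + 1) * θ) with hsdef
  -- Zero for a regular half-turn, since sin((k+2)θ) e^{i(k+1)θ} − sin((k+1)θ) e^{i(k+2)θ} = sin θ.
  set q : ℕ → F := fun k => s (k + 1) • v (k + 1) - s k • v (k + 2) - Real.sin θ • v 0 with hq
  -- Telescoping term: it absorbs the inner products with `v 0` that appear in ‖q k‖², so that only
  -- the two ends survive summation.
  set G : ℕ → ℝ := fun k =>
    2 * Real.sin θ * (Real.cos ((k + 1) * θ) - ⟪v (k + 1), v 0⟫_ℝ) / s k with hG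
  have hvv : ∀ k < m + 2, ⟪v k, v k⟫_ℝ = 1 := fun k hk => by
    rw [real_inner_self_eq_norm_sq, hv k hk, one_pow]
  have hterm : ∀ k < m, ‖q k‖ ^ 2 / (s k * s (k + 1)) =
      2 * Real.cos θ + (G k - G (k + 1)) - 2 * ⟪v (k + 1), v (k + 2)⟫_ℝ := fun k hk => by
    have h1 : 0 < s k := hs k (by omega)
    have h2 : 0 < s (k + 1) := by simpa [hsdef] using hs (k + 1) (by omega)
    have h3 : s (k + 1) = s k * Real.cos θ + Real.cos ((k + 1) * θ) * Real.sin θ := by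
      simp only [hsdef]; push_cast; exact hss k
    have h4 : Real.cos (((k + 1 : ℕ) + 1) * θ) =
        Real.cos ((k + 1) * θ) * Real.cos θ - s k * Real.sin θ := by
      push_cast; exact hcs k
    have h5 : s k ^ 2 + Real.cos ((k + 1) * θ) ^ 2 = 1 := Real.sin_sq_add_cos_sq _
    have h6 := Real.sin_sq_add_cos_sq θ
    have h7 : ‖q k‖ ^ 2 = s (k + 1) ^ 2 + s k ^ 2 + Real.sin θ ^ 2
        - 2 * s (k + 1) * s k * ⟪v (k + 1), v (k + 2)⟫_ℝ
        - 2 * s (k + 1) * Real.sin θ * ⟪v (k + 1), v 0⟫_ℝ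
        + 2 * s k * Real.sin θ * ⟪v (k + 2), v 0⟫_ℝ := by
      rw [← real_inner_self_eq_norm_sq]
      simp only [hq, inner_sub_left, inner_sub_right, real_inner_smul_left, real_inner_smul_right,
        hvv (k + 1) (by omega), hvv (k + 2) (by omega), hvv 0 (by omega),
        real_inner_comm (v (k + 1)) (v 0), real_inner_comm (v (k + 2)) (v 0),
        real_inner_comm (v (k + 2)) (v (k + 1))]
      ring
    rw [h7]
    simp only [hG, h4]
    field_simp
    set c := Real.cos ((k + 1) * θ)
    set t := s (k + 1)
    have h8 : t ^ 2 + s k ^ 2 + Real.sin θ ^ 2 = 2 * Real.cos θ * (s k * t) +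
        2 * Real.sin θ * (c * t - (c * Real.cos θ - s k * Real.sin θ) * s k) := by
      rw [h3]; linear_combination (-Real.sin θ ^ 2) * h5 - (s k ^ 2) * h6
    linear_combination h8
  -- The end values supply the two links of the chain that no `q k` sees: from `v 0` to `v 1`, and
  -- from `v (m + 1)` to `-v 0`.
  have hG0 : G 0 = 2 * (Real.cos θ - ⟪v 1, v 0⟫_ℝ) := by
    simp only [hG, hsdef]; norm_num; field_simp
  have hang : ((m : ℝ) + 1) * θ = Real.pi - θ := by linarith
  have hGm : G m = 2 * (-Real.cos θ - ⟪v (m + 1), v 0⟫_ℝ) := by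
    simp only [hG, hsdef, hang, Real.sin_pi_sub, Real.cos_pi_sub]; field_simp
  -- The sum of the weighted squares is 2(N cos θ − ∑⟨v_k, v_{k+1}⟩), which is zero by `hsum`.
  have hqsum : ∑ k ∈ Finset.range m, ‖q k‖ ^ 2 / (s k * s (k + 1)) = 0 := by
    rw [Finset.sum_congr rfl fun k hk => hterm k (Finset.mem_range.1 hk),
      Finset.sum_sub_distrib, Finset.sum_add_distrib, Finset.sum_range_sub', hG0, hGm]
    rw [Finset.sum_range_succ, Finset.sum_range_succ', hvN, inner_neg_right] at hsum
    rw [Finset.sum_const, Finset.card_range, nsmul_eq_mul, ← Finset.mul_sum]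
    push_cast at hsum
    simp only [add_assoc, one_add_one_eq_two] at hsum
    rw [real_inner_comm (v 1) (v 0)] at *
    linarith
  have hq0 : ∀ k < m, q k = 0 := fun k hk => by
    have hpos : ∀ k < m, 0 < s k * s (k + 1) := fun k hk =>
      mul_pos (hs k (by omega)) (by simpa [hsdef] using hs (k + 1) (by omega))
    have h := (Finset.sum_eq_zero_iff_of_nonneg fun k hk =>
      div_nonneg (sq_nonneg _) (hpos k (Finset.mem_range.1 hk)).le).1 hqsum k
        (Finset.mem_range.2 hk)
    rcases div_eq_zero_iff.1 h with h | h
    · exact norm_eq_zero.1 ((pow_eq_zero_iff two_ne_zero).1 h)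
    · exact absurd h (hpos k hk).ne'
  -- The case k = 1 forces this choice of w; the equations q k = 0 then give `v (k + 2)` from `v (k
  -- + 1)` and `v 0`.
  refine ⟨(Real.sin θ)⁻¹ • (v 1 - Real.cos θ • v 0), fun k hk => ?_⟩
  rcases k with _ | k
  · simp
  · induction k with
    | zero => simp [smul_smul, hs1.ne']
    | succ k ih =>
      have ih := ih (by omega)
      have h := hq0 k (by omega)
      have h1 : s k ≠ 0 := (hs k (by omega)).ne'
      have h2 : v (k + 2) = (s k)⁻¹ • (s (k + 1) • v (k + 1) - Real.sin θ • v 0) := by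
        rw [eq_inv_smul_iff₀ h1]
        simp only [hq] at h
        rw [sub_right_comm, sub_eq_zero] at h
        exact h.symm
      have h3 : s (k + 1) = s k * Real.cos θ + Real.cos ((k + 1) * θ) * Real.sin θ := by
        simp only [hsdef]; push_cast; exact hss k
      have h5 : s k ^ 2 + Real.cos ((k + 1) * θ) ^ 2 = 1 := Real.sin_sq_add_cos_sq _
      have h4 : Real.cos (((k + 1 + 1 : ℕ) : ℝ) * θ) =
          Real.cos ((k + 1) * θ) * Real.cos θ - s k * Real.sin θ := by
        push_cast; exact hcs k
      have h6 : Real.sin (((k + 1 + 1 : ℕ) : ℝ) * θ) = s (k + 1) := by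
        simp only [hsdef]; push_cast; rfl
      have h7 : Real.sin (((k + 1 : ℕ) : ℝ) * θ) = s k := by
        simp only [hsdef]; push_cast; rfl
      have h8 : (s (k + 1) * Real.cos ((k + 1) * θ) - Real.sin θ) * (s k)⁻¹ =
          Real.cos ((k + 1) * θ) * Real.cos θ - s k * Real.sin θ := by
        field_simp
        rw [h3]; linear_combination Real.sin θ * h5
      rw [h7, Nat.cast_succ] at ih
      rw [h4, h6, show k + 1 + 1 = k + 2 from rfl, h2, ih, ← h8]
      generalize v 1 - Real.cos θ • v 0 = y
      match_scalars
      · ring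
      · field_simp

end Rigidity

/-! ### Qubit gates and the reference states in Bell vectors -/

section Qubits

theorem hadamard_ket_zero : hadamard (ket 0) = ((1 / √2 : ℝ) : ℂ) • (ket 0 + ket 1) := by
  ext i; fin_cases i <;> simp [hadamard, ket, Matrix.ofLp_toEuclideanCLM]

theorem hadamard_ket_one : hadamard (ket 1) = ((1 / √2 : ℝ) : ℂ) • (ket 0 - ket 1) := by
  ext i; fin_cases i <;> simp [hadamard, ket, Matrix.ofLp_toEuclideanCLM]

theorem proj0_ket_zero : proj0 (ket 0) = ket 0 := by
  ext i; fin_cases i <;> simp [proj0, ket, Matrix.ofLp_toEuclideanCLM]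

theorem proj0_ket_one : proj0 (ket 1) = 0 := by
  ext i; fin_cases i <;> simp [proj0, ket, Matrix.ofLp_toEuclideanCLM]

theorem proj1_ket_zero : proj1 (ket 0) = 0 := by
  ext i; fin_cases i <;> simp [proj1, ket, Matrix.ofLp_toEuclideanCLM]

theorem proj1_ket_one : proj1 (ket 1) = ket 1 := by
  ext i; fin_cases i <;> simp [proj1, ket, Matrix.ofLp_toEuclideanCLM]

theorem planar_ket_zero (t : ℝ) :
    planar t (ket 0) = (Real.cos t : ℂ) • ket 0 + (Real.sin t : ℂ) • ket 1 := by
  ext i; fin_cases i <;> simp [planar, pauliX, pauliZ, ket, Matrix.ofLp_toEuclideanCLM]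

theorem planar_ket_one (t : ℝ) :
    planar t (ket 1) = (Real.sin t : ℂ) • ket 0 - (Real.cos t : ℂ) • ket 1 := by
  ext i; fin_cases i <;> simp [planar, pauliX, pauliZ, ket, Matrix.ofLp_toEuclideanCLM]

theorem ofReal_inv_sqrt_two_mul_self :
    ((1 / √2 : ℝ) : ℂ) * ((1 / √2 : ℝ) : ℂ) = 1 / 2 := by
  rw [← Complex.ofReal_mul, div_mul_div_comm, Real.mul_self_sqrt zero_le_two]
  norm_num

theorem star_hadamard : star hadamard = hadamard := by
  rw [hadamard, star_smul, ← map_star]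
  congr 1
  · exact Complex.conj_ofReal _
  · congr 1
    ext i j; fin_cases i <;> fin_cases j <;> simp [Matrix.star_apply]

theorem hadamard_mul_self : hadamard * hadamard = 1 := by
  rw [hadamard, smul_mul_smul_comm, ofReal_inv_sqrt_two_mul_self, ← map_mul, ← map_smul,
    ← map_one (Matrix.toEuclideanCLM (n := Fin 2) (𝕜 := ℂ))]
  congr 1
  ext i j; fin_cases i <;> fin_cases j <;> simp <;> norm_num

theorem star_proj0 : star proj0 = proj0 := by
  rw [proj0, ← map_star]
  congr 1
  ext i j; fin_cases i <;> fin_cases j <;> simp [Matrix.star_apply]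

theorem star_proj1 : star proj1 = proj1 := by
  rw [proj1, ← map_star]
  congr 1
  ext i j; fin_cases i <;> fin_cases j <;> simp [Matrix.star_apply]

theorem proj0_mul_proj0 : proj0 * proj0 = proj0 := by
  rw [proj0, ← map_mul]; congr 1
  ext i j; fin_cases i <;> fin_cases j <;> simp

theorem proj1_mul_proj1 : proj1 * proj1 = proj1 := by
  rw [proj1, ← map_mul]; congr 1
  ext i j; fin_cases i <;> fin_cases j <;> simp

theorem proj0_mul_proj1 : proj0 * proj1 = 0 := by
  rw [proj0, proj1, ← map_mul, ← map_zero (Matrix.toEuclideanCLM (n := Fin 2) (𝕜 := ℂ))]; congr 1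
  ext i j; fin_cases i <;> fin_cases j <;> simp

theorem proj1_mul_proj0 : proj1 * proj0 = 0 := by
  rw [proj0, proj1, ← map_mul, ← map_zero (Matrix.toEuclideanCLM (n := Fin 2) (𝕜 := ℂ))]; congr 1
  ext i j; fin_cases i <;> fin_cases j <;> simp

theorem proj0_add_proj1 : proj0 + proj1 = 1 := by
  rw [proj0, proj1, ← map_add, ← map_one (Matrix.toEuclideanCLM (n := Fin 2) (𝕜 := ℂ))]; congr 1
  ext i j; fin_cases i <;> fin_cases j <;> simp

theorem inner_ket_zero_ket_one : ⟪ket 0, ket 1⟫_ℂ = 0 := by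
  simp [ket, EuclideanSpace.inner_single_left]

theorem norm_ket (k : Fin 2) : ‖ket k‖ = 1 := by simp [ket]

theorem norm_inv_sqrt_two_smul_add {G : Type*} [NormedAddCommGroup G] [InnerProductSpace ℂ G]
    {x y : G} (hx : ‖x‖ = 1) (hy : ‖y‖ = 1) (hxy : ⟪x, y⟫_ℂ = 0) :
    ‖((1 / √2 : ℝ) : ℂ) • (x + y)‖ = 1 := by
  have h : ‖x + y‖ * ‖x + y‖ = 2 := by
    rw [norm_add_mul_self (𝕜 := ℂ), hxy, hx, hy]
    norm_num
  rw [norm_smul, Complex.norm_real, Real.norm_of_nonneg (by positivity), ← h,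
    Real.sqrt_mul_self (norm_nonneg _)]
  have h' : ‖x + y‖ ≠ 0 := fun h' => by norm_num [h'] at h
  field_simp

theorem norm_phiPlus : ‖phiPlus‖ = 1 := by
  have hk : ∀ k, ‖ket k ⊗ₜ[ℂ] ket k‖ = 1 := fun k => by
    rw [TensorProduct.norm_tmul, norm_ket, mul_one]
  have h : ⟪ket 0 ⊗ₜ[ℂ] ket 0, ket 1 ⊗ₜ[ℂ] ket 1⟫_ℂ = 0 := by
    rw [TensorProduct.inner_tmul, inner_ket_zero_ket_one, mul_zero]
  exact norm_inv_sqrt_two_smul_add (hk 0) (hk 1) h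

/-- The two Bell vectors on the right are those that `IsSwapFrame.circuit_apply` attaches to ψ and
XZψ, so coefficients can be matched directly. -/
theorem mapL_planar_planar_phiPlus (s t : ℝ) :
    TensorProduct.mapL (planar s) (planar t) phiPlus = ((1 / √2 : ℝ) : ℂ) •
      ((Real.cos (s - t) : ℂ) • (ket 0 ⊗ₜ[ℂ] ket 0 + ket 1 ⊗ₜ[ℂ] ket 1) +
        (Real.sin (s - t) : ℂ) • (ket 1 ⊗ₜ[ℂ] ket 0 - ket 0 ⊗ₜ[ℂ] ket 1)) := by
  rw [phiPlus, map_smul, map_add, TensorProduct.mapL_tmul, TensorProduct.mapL_tmul,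
    planar_ket_zero, planar_ket_zero, planar_ket_one, planar_ket_one, Real.cos_sub, Real.sin_sub]
  simp only [TensorProduct.add_tmul, TensorProduct.tmul_add, TensorProduct.sub_tmul,
    TensorProduct.tmul_sub, ← TensorProduct.smul_tmul', TensorProduct.tmul_smul]
  push_cast
  module

theorem mapL_planar_one_phiPlus (s : ℝ) :
    TensorProduct.mapL (planar s) 1 phiPlus = ((1 / √2 : ℝ) : ℂ) •
      ((Real.cos s : ℂ) • (ket 0 ⊗ₜ[ℂ] ket 0 - ket 1 ⊗ₜ[ℂ] ket 1) +
        (Real.sin s : ℂ) • (ket 1 ⊗ₜ[ℂ] ket 0 + ket 0 ⊗ₜ[ℂ] ket 1)) := by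
  rw [phiPlus, map_smul, map_add, TensorProduct.mapL_tmul, TensorProduct.mapL_tmul,
    planar_ket_zero, planar_ket_one, one_apply_eq_self, one_apply_eq_self]
  simp only [TensorProduct.add_tmul, TensorProduct.sub_tmul, ← TensorProduct.smul_tmul']
  module

/-- The right-hand side agrees with that for Alice's qubit: the matrix of `planar` is symmetric, so
it can be moved across `phiPlus`. -/
theorem mapL_one_planar_phiPlus (t : ℝ) :
    TensorProduct.mapL 1 (planar t) phiPlus = ((1 / √2 : ℝ) : ℂ) •
      ((Real.cos t : ℂ) • (ket 0 ⊗ₜ[ℂ] ket 0 - ket 1 ⊗ₜ[ℂ] ket 1) +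
        (Real.sin t : ℂ) • (ket 1 ⊗ₜ[ℂ] ket 0 + ket 0 ⊗ₜ[ℂ] ket 1)) := by
  rw [phiPlus, map_smul, map_add, TensorProduct.mapL_tmul, TensorProduct.mapL_tmul,
    planar_ket_zero, planar_ket_one, one_apply_eq_self, one_apply_eq_self]
  simp only [TensorProduct.tmul_add, TensorProduct.tmul_sub, TensorProduct.tmul_smul]
  module

end Qubits

/-! ### Unitarity of the swap circuit -/

section Unitarity

/-- `T` has a formal adjoint that is a two-sided inverse. -/
def IsFormallyUnitary {E : Type*} [NormedAddCommGroup E] [InnerProductSpace ℂ E]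
    (T : E →L[ℂ] E) : Prop :=
  ∃ S, IsFormalAdjoint T S ∧ S * T = 1 ∧ T * S = 1

theorem IsFormallyUnitary.comp {E : Type*} [NormedAddCommGroup E] [InnerProductSpace ℂ E]
    {T T' : E →L[ℂ] E} (h : IsFormallyUnitary T) (h' : IsFormallyUnitary T') :
    IsFormallyUnitary (T ∘L T') := by
  obtain ⟨S, hS, h₁, h₂⟩ := h
  obtain ⟨S', hS', h₁', h₂'⟩ := h'
  refine ⟨S' * S, fun x y => ?_, ?_, ?_⟩
  · rw [ContinuousLinearMap.comp_apply, hS, hS', mul_apply_eq_comp]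
  · change S' * S * (T * T') = 1
    rw [mul_assoc, ← mul_assoc S, h₁, one_mul, h₁']
  · change T * T' * (S' * S) = 1
    rw [mul_assoc, ← mul_assoc T', h₂', one_mul, h₂]

variable {HA HB : Type*} [NormedAddCommGroup HA] [InnerProductSpace ℂ HA]
  [NormedAddCommGroup HB] [InnerProductSpace ℂ HB]

theorem mapL_one_one {E F : Type*} [NormedAddCommGroup E] [InnerProductSpace ℂ E]
    [NormedAddCommGroup F] [InnerProductSpace ℂ F] :
    TensorProduct.mapL (1 : E →L[ℂ] E) (1 : F →L[ℂ] F) = 1 :=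
  TensorProduct.mapL_id_id

theorem isFormallyUnitary_gateA_hadamard :
    IsFormallyUnitary (E := CircuitSpace HA HB) (gateA (HA := HA) (HB := HB) hadamard) := by
  have h : gateA (HA := HA) (HB := HB) hadamard * gateA hadamard = 1 := by
    rw [gateA, ← TensorProduct.mapL_mul, ← TensorProduct.mapL_mul, hadamard_mul_self, one_mul,
      one_mul, mapL_one_one, mapL_one_one]
  refine ⟨_, IsFormalAdjoint.one.mapL (IsFormalAdjoint.mapL ?_ .one), h, h⟩
  simpa only [star_hadamard] using isFormalAdjoint_star hadamard

theorem isFormallyUnitary_gateB_hadamard :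
    IsFormallyUnitary (E := CircuitSpace HA HB) (gateB (HA := HA) (HB := HB) hadamard) := by
  have h : gateB (HA := HA) (HB := HB) hadamard * gateB hadamard = 1 := by
    rw [gateB, ← TensorProduct.mapL_mul, ← TensorProduct.mapL_mul, hadamard_mul_self, one_mul,
      one_mul, mapL_one_one, mapL_one_one]
  refine ⟨_, IsFormalAdjoint.one.mapL (IsFormalAdjoint.mapL .one ?_), h, h⟩
  simpa only [star_hadamard] using isFormalAdjoint_star hadamard

theorem isFormalAdjoint_proj0 : IsFormalAdjoint proj0 proj0 := by
  simpa only [star_proj0] using isFormalAdjoint_star proj0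

theorem isFormalAdjoint_proj1 : IsFormalAdjoint proj1 proj1 := by
  simpa only [star_proj1] using isFormalAdjoint_star proj1

/-- Controlled gates multiply blockwise because `proj0` and `proj1` are orthogonal projectors with
sum one. -/
theorem controlledA_mul_controlledA {U V : HA →L[ℂ] HA} (h : U * V = 1) :
    controlledA (HB := HB) U * controlledA V = 1 := by
  simp only [controlledA, add_mul, mul_add, ← TensorProduct.mapL_mul, ← tensorOp_mul, h,
    proj0_mul_proj0, proj0_mul_proj1, proj1_mul_proj0, proj1_mul_proj1, one_mul, tensorOp_one,
    TensorProduct.mapL_zero_left, TensorProduct.mapL_zero_right, add_zero, zero_add]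
  rw [← TensorProduct.mapL_add_right, ← TensorProduct.mapL_add_left, proj0_add_proj1,
    mapL_one_one, mapL_one_one]

theorem controlledB_mul_controlledB {U V : HB →L[ℂ] HB} (h : U * V = 1) :
    controlledB (HA := HA) U * controlledB V = 1 := by
  simp only [controlledB, add_mul, mul_add, ← TensorProduct.mapL_mul, ← tensorOp_mul, h,
    proj0_mul_proj0, proj0_mul_proj1, proj1_mul_proj0, proj1_mul_proj1, one_mul, tensorOp_one,
    TensorProduct.mapL_zero_right, add_zero, zero_add]
  rw [← TensorProduct.mapL_add_right, ← TensorProduct.mapL_add_right, proj0_add_proj1,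
    mapL_one_one, mapL_one_one]

variable [CompleteSpace HA] [CompleteSpace HB]

theorem isFormallyUnitary_controlledA {U : HA →L[ℂ] HA} (hU : U ∈ unitary (HA →L[ℂ] HA)) :
    IsFormallyUnitary (E := CircuitSpace HA HB) (controlledA (HB := HB) U) := by
  refine ⟨controlledA (star U), ?_, controlledA_mul_controlledA (Unitary.mem_iff.1 hU).1,
    controlledA_mul_controlledA (Unitary.mem_iff.1 hU).2⟩
  refine (IsFormalAdjoint.one.mapL (isFormalAdjoint_proj0.mapL .one)).add
    (IsFormalAdjoint.mapL ?_ (isFormalAdjoint_proj1.mapL .one))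
  simpa only [star_one] using isFormalAdjoint_tensorOp U (1 : HB →L[ℂ] HB)

theorem isFormallyUnitary_controlledB {U : HB →L[ℂ] HB} (hU : U ∈ unitary (HB →L[ℂ] HB)) :
    IsFormallyUnitary (E := CircuitSpace HA HB) (controlledB (HA := HA) U) := by
  refine ⟨controlledB (star U), ?_, controlledB_mul_controlledB (Unitary.mem_iff.1 hU).1,
    controlledB_mul_controlledB (Unitary.mem_iff.1 hU).2⟩
  refine (IsFormalAdjoint.one.mapL (IsFormalAdjoint.one.mapL isFormalAdjoint_proj0)).add
    (IsFormalAdjoint.mapL ?_ (IsFormalAdjoint.one.mapL isFormalAdjoint_proj1))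
  simpa only [star_one] using isFormalAdjoint_tensorOp (1 : HA →L[ℂ] HA) U

theorem isFormallyUnitary_circuitA {X Z : HA →L[ℂ] HA} (hX : X ∈ unitary (HA →L[ℂ] HA))
    (hZ : Z ∈ unitary (HA →L[ℂ] HA)) : IsFormallyUnitary (E := CircuitSpace HA HB) (circuitA (HB := HB) X Z) :=
  (isFormallyUnitary_controlledA hX).comp (isFormallyUnitary_gateA_hadamard.comp
    ((isFormallyUnitary_controlledA hZ).comp isFormallyUnitary_gateA_hadamard))

theorem isFormallyUnitary_circuitB {X Z : HB →L[ℂ] HB} (hX : X ∈ unitary (HB →L[ℂ] HB))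
    (hZ : Z ∈ unitary (HB →L[ℂ] HB)) : IsFormallyUnitary (E := CircuitSpace HA HB) (circuitB (HA := HA) X Z) :=
  (isFormallyUnitary_controlledB hX).comp (isFormallyUnitary_gateB_hadamard.comp
    ((isFormallyUnitary_controlledB hZ).comp isFormallyUnitary_gateB_hadamard))

end Unitarity

/-! ### Action of the gates on ancilla basis states -/

section Evaluation

variable {HA HB : Type*} [NormedAddCommGroup HA] [InnerProductSpace ℂ HA]
  [NormedAddCommGroup HB] [InnerProductSpace ℂ HB]

theorem controlledA_tmul_zero (U : HA →L[ℂ] HA) (v : JointSpace HA HB) (b : Qubit) :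
    controlledA U (v ⊗ₜ[ℂ] (ket 0 ⊗ₜ[ℂ] b)) = v ⊗ₜ[ℂ] (ket 0 ⊗ₜ[ℂ] b) := by
  simp only [controlledA, add_apply, TensorProduct.mapL_tmul, proj0_ket_zero, proj1_ket_zero,
    TensorProduct.zero_tmul, TensorProduct.tmul_zero, one_apply_eq_self, add_zero]

theorem controlledB_tmul_zero (U : HB →L[ℂ] HB) (v : JointSpace HA HB) (a : Qubit) :
    controlledB U (v ⊗ₜ[ℂ] (a ⊗ₜ[ℂ] ket 0)) = v ⊗ₜ[ℂ] (a ⊗ₜ[ℂ] ket 0) := by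
  simp only [controlledB, add_apply, TensorProduct.mapL_tmul, proj0_ket_zero, proj1_ket_zero,
    TensorProduct.tmul_zero, one_apply_eq_self, add_zero]

theorem gateA_hadamard_tmul_zero (v : JointSpace HA HB) (b : Qubit) :
    gateA hadamard (v ⊗ₜ[ℂ] (ket 0 ⊗ₜ[ℂ] b)) = ((1 / √2 : ℝ) : ℂ) •
      (v ⊗ₜ[ℂ] (ket 0 ⊗ₜ[ℂ] b) + v ⊗ₜ[ℂ] (ket 1 ⊗ₜ[ℂ] b)) := by
  rw [gateA, TensorProduct.mapL_tmul, TensorProduct.mapL_tmul, hadamard_ket_zero,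
    ← TensorProduct.smul_tmul', TensorProduct.add_tmul, TensorProduct.tmul_smul,
    TensorProduct.tmul_add]
  rfl

theorem gateA_hadamard_tmul_one (v : JointSpace HA HB) (b : Qubit) :
    gateA hadamard (v ⊗ₜ[ℂ] (ket 1 ⊗ₜ[ℂ] b)) = ((1 / √2 : ℝ) : ℂ) •
      (v ⊗ₜ[ℂ] (ket 0 ⊗ₜ[ℂ] b) - v ⊗ₜ[ℂ] (ket 1 ⊗ₜ[ℂ] b)) := by
  rw [gateA, TensorProduct.mapL_tmul, TensorProduct.mapL_tmul, hadamard_ket_one,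
    ← TensorProduct.smul_tmul', TensorProduct.sub_tmul, TensorProduct.tmul_smul,
    TensorProduct.tmul_sub]
  rfl

theorem gateB_hadamard_tmul_zero (v : JointSpace HA HB) (a : Qubit) :
    gateB hadamard (v ⊗ₜ[ℂ] (a ⊗ₜ[ℂ] ket 0)) = ((1 / √2 : ℝ) : ℂ) •
      (v ⊗ₜ[ℂ] (a ⊗ₜ[ℂ] ket 0) + v ⊗ₜ[ℂ] (a ⊗ₜ[ℂ] ket 1)) := by
  rw [gateB, TensorProduct.mapL_tmul, TensorProduct.mapL_tmul, hadamard_ket_zero,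
    TensorProduct.tmul_smul, TensorProduct.tmul_add, TensorProduct.tmul_smul,
    TensorProduct.tmul_add]
  rfl

theorem gateB_hadamard_tmul_one (v : JointSpace HA HB) (a : Qubit) :
    gateB hadamard (v ⊗ₜ[ℂ] (a ⊗ₜ[ℂ] ket 1)) = ((1 / √2 : ℝ) : ℂ) •
      (v ⊗ₜ[ℂ] (a ⊗ₜ[ℂ] ket 0) - v ⊗ₜ[ℂ] (a ⊗ₜ[ℂ] ket 1)) := by
  rw [gateB, TensorProduct.mapL_tmul, TensorProduct.mapL_tmul, hadamard_ket_one,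
    TensorProduct.tmul_smul, TensorProduct.tmul_sub, TensorProduct.tmul_smul,
    TensorProduct.tmul_sub]
  rfl

variable [CompleteSpace HA] [CompleteSpace HB]

theorem controlledA_tmul_one (U : HA →L[ℂ] HA) (v : JointSpace HA HB) (b : Qubit) :
    controlledA U (v ⊗ₜ[ℂ] (ket 1 ⊗ₜ[ℂ] b)) =
      leftRep HA HB U v ⊗ₜ[ℂ] (ket 1 ⊗ₜ[ℂ] b) := by
  simp only [controlledA, add_apply, TensorProduct.mapL_tmul, proj0_ket_one, proj1_ket_one,
    TensorProduct.zero_tmul, TensorProduct.tmul_zero, one_apply_eq_self, zero_add]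
  rfl

theorem controlledB_tmul_one (U : HB →L[ℂ] HB) (v : JointSpace HA HB) (a : Qubit) :
    controlledB U (v ⊗ₜ[ℂ] (a ⊗ₜ[ℂ] ket 1)) =
      rightRep HA HB U v ⊗ₜ[ℂ] (a ⊗ₜ[ℂ] ket 1) := by
  simp only [controlledB, add_apply, TensorProduct.mapL_tmul, proj0_ket_one, proj1_ket_one,
    TensorProduct.tmul_zero, one_apply_eq_self, zero_add]
  rfl

/-- Hadamard, controlled Z, Hadamard split v into (1 + Z)v/2 and (1 − Z)v/2, flagged by the ancilla;
the controlled X acts on the second branch only. No relation between X and Z enters. -/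
theorem circuitA_tmul_zero (X Z : HA →L[ℂ] HA) (v : JointSpace HA HB) (b : Qubit) :
    circuitA X Z (v ⊗ₜ[ℂ] (ket 0 ⊗ₜ[ℂ] b)) = (1 / 2 : ℂ) •
      ((v + leftRep HA HB Z v) ⊗ₜ[ℂ] (ket 0 ⊗ₜ[ℂ] b) +
        (leftRep HA HB X (v - leftRep HA HB Z v)) ⊗ₜ[ℂ] (ket 1 ⊗ₜ[ℂ] b)) := by
  simp only [circuitA, ContinuousLinearMap.comp_apply, gateA_hadamard_tmul_zero, map_smul, map_add,
    controlledA_tmul_zero, controlledA_tmul_one, gateA_hadamard_tmul_one, map_sub,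
    ← ofReal_inv_sqrt_two_mul_self, TensorProduct.add_tmul, TensorProduct.sub_tmul]
  module

theorem circuitB_tmul_zero (X Z : HB →L[ℂ] HB) (v : JointSpace HA HB) (a : Qubit) :
    circuitB X Z (v ⊗ₜ[ℂ] (a ⊗ₜ[ℂ] ket 0)) = (1 / 2 : ℂ) •
      ((v + rightRep HA HB Z v) ⊗ₜ[ℂ] (a ⊗ₜ[ℂ] ket 0) +
        (rightRep HA HB X (v - rightRep HA HB Z v)) ⊗ₜ[ℂ] (a ⊗ₜ[ℂ] ket 1)) := by
  simp only [circuitB, ContinuousLinearMap.comp_apply, gateB_hadamard_tmul_zero, map_smul, map_add,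
    controlledB_tmul_zero, controlledB_tmul_one, gateB_hadamard_tmul_one, map_sub,
    ← ofReal_inv_sqrt_two_mul_self, TensorProduct.add_tmul, TensorProduct.sub_tmul]
  module

end Evaluation

/-! ### Rigidity in a complex Hilbert space -/

section ComplexRigidity

/-- The real part of a complex inner product is a real one with the same norm, so the real rigidity
applies and the coefficients stay real. -/
theorem planar_of_sum_re_inner_eq {K : Type*} [NormedAddCommGroup K] [InnerProductSpace ℂ K]
    {N : ℕ} (hN : 3 ≤ N) (v : ℕ → K) (hv : ∀ k < N, ‖v k‖ = 1) (hvN : v N = -v 0)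
    (hsum : ∑ k ∈ Finset.range N, (⟪v k, v (k + 1)⟫_ℂ).re = N * Real.cos (Real.pi / N)) :
    ∃ w : K, ∀ k < N, v k = ((Real.cos (k * (Real.pi / N)) : ℝ) : ℂ) • v 0 +
      ((Real.sin (k * (Real.pi / N)) : ℝ) : ℂ) • w := by
  let _ : InnerProductSpace ℝ K := InnerProductSpace.complexToReal
  obtain ⟨w, hw⟩ := planar_of_sum_inner_eq hN v hv hvN hsum
  refine ⟨w, fun k hk => ?_⟩
  rw [Complex.coe_smul, Complex.coe_smul]
  exact hw k hk

theorem sum_range_two_mul {M : Type*} [AddCommMonoid M] (f : ℕ → M) (n : ℕ) :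
    ∑ k ∈ Finset.range (2 * n), f k =
      ∑ k ∈ Finset.range n, (f (2 * k) + f (2 * k + 1)) := by
  induction n with
  | zero => simp
  | succ n ih =>
    rw [show 2 * (n + 1) = 2 * n + 1 + 1 from rfl, Finset.sum_range_succ, Finset.sum_range_succ,
      Finset.sum_range_succ, ih, add_assoc]

end ComplexRigidity

/-! ### Observables under a representation -/

section Observables

theorem next_of_le {H : Type*} [NormedAddCommGroup H] [InnerProductSpace ℂ H] {n k : ℕ}
    (A : ℕ → H →L[ℂ] H) (hk : k ≤ n) : next n A k = A k :=
  if_neg (by omega)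

variable {H K : Type*} [NormedAddCommGroup H] [InnerProductSpace ℂ H] [CompleteSpace H]
  [NormedAddCommGroup K] [InnerProductSpace ℂ K] [CompleteSpace K]

theorem inner_map_left (π : (H →L[ℂ] H) →⋆ₐ[ℂ] (K →L[ℂ] K)) {C : H →L[ℂ] H}
    (hC : IsSelfAdjoint C) (x y : K) : ⟪π C x, y⟫_ℂ = ⟪x, π C y⟫_ℂ := by
  rw [isFormalAdjoint_star (π C), ← map_star, hC.star_eq]

theorem IsObservable.map_map (π : (H →L[ℂ] H) →⋆ₐ[ℂ] (K →L[ℂ] K)) {C : H →L[ℂ] H}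
    (hC : IsObservable C) (x : K) : π C (π C x) = x := by
  rw [← mul_apply_eq_comp, ← map_mul, hC.2, map_one, one_apply_eq_self]

theorem IsObservable.norm_map (π : (H →L[ℂ] H) →⋆ₐ[ℂ] (K →L[ℂ] K)) {C : H →L[ℂ] H}
    (hC : IsObservable C) (x : K) : ‖π C x‖ = ‖x‖ := by
  have h : ⟪π C x, π C x⟫_ℂ = ⟪x, x⟫_ℂ := by rw [inner_map_left π hC.1, hC.map_map]
  rw [inner_self_eq_norm_sq_to_K, inner_self_eq_norm_sq_to_K] at h
  have h' : ‖π C x‖ ^ 2 = ‖x‖ ^ 2 := by exact_mod_cast h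
  exact (sq_eq_sq₀ (norm_nonneg _) (norm_nonneg _)).1 h'

theorem IsObservable.neg {C : H →L[ℂ] H} (hC : IsObservable C) : IsObservable (-C) :=
  ⟨hC.1.neg, by rw [neg_mul_neg, hC.2]⟩

theorem isObservable_next {n : ℕ} (hn : 2 ≤ n) {A : ℕ → H →L[ℂ] H}
    (hA : ∀ i ∈ Finset.Icc 1 n, IsObservable (A i)) {k : ℕ} (hk : k ∈ Finset.Icc 1 (n + 1)) :
    IsObservable (next n A k) := by
  rw [Finset.mem_Icc] at hk
  unfold next
  split_ifs with h
  · exact (hA 1 (Finset.mem_Icc.2 (by omega))).neg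
  · exact hA k (Finset.mem_Icc.2 (by omega))

end Observables

/-! ### From maximal violation to the plane, and the swap relations -/

section MaximalViolation

variable {HA HB : Type*} [NormedAddCommGroup HA] [InnerProductSpace ℂ HA]
  [NormedAddCommGroup HB] [InnerProductSpace ℂ HB] [CompleteSpace HA] [CompleteSpace HB]

/-- At the maximal violation the observables of both parties send the state into a plane, at the
angles of the reference measurements. -/
theorem exists_planar_of_maximal {n : ℕ} (hn : 2 ≤ n)
    {A : ℕ → HA →L[ℂ] HA} {B : ℕ → HB →L[ℂ] HB}
    (hA : ∀ i ∈ Finset.Icc 1 n, IsObservable (A i))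
    (hB : ∀ i ∈ Finset.Icc 1 n, IsObservable (B i))
    {ψ : JointSpace HA HB} (hψ : ‖ψ‖ = 1)
    (hmax : ⟪ψ, bellOperator n A B ψ⟫_ℂ =
      ((2 * n * Real.cos (Real.pi / (2 * n)) : ℝ) : ℂ)) :
    ∃ f : JointSpace HA HB,
      (∀ i ∈ Finset.Icc 1 n, leftRep HA HB (A i) ψ =
        ((Real.cos (((i : ℝ) - 1) * Real.pi / n) : ℝ) : ℂ) • leftRep HA HB (A 1) ψ +
          ((Real.sin (((i : ℝ) - 1) * Real.pi / n) : ℝ) : ℂ) • f) ∧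
      ∀ j ∈ Finset.Icc 1 n, rightRep HA HB (B j) ψ =
        ((Real.cos ((2 * (j : ℝ) - 1) * Real.pi / (2 * n)) : ℝ) : ℂ) • leftRep HA HB (A 1) ψ +
          ((Real.sin ((2 * (j : ℝ) - 1) * Real.pi / (2 * n)) : ℝ) : ℂ) • f := by
  have hn0 : (n : ℝ) ≠ 0 := by positivity
  -- The chain: position 2i carries Aᵢ₊₁ψ and position 2i + 1 carries Bᵢ₊₁ψ, the observables being
  -- numbered from 1. The sign convention in `next` makes position 2n equal to −v₀.
  set v : ℕ → JointSpace HA HB := fun k =>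
    if Even k then leftRep HA HB (next n A (k / 2 + 1)) ψ
    else rightRep HA HB (B (k / 2 + 1)) ψ with hvdef
  have hve : ∀ i, v (2 * i) = leftRep HA HB (next n A (i + 1)) ψ := fun i => by
    simp [hvdef]
  have hvo : ∀ i, v (2 * i + 1) = rightRep HA HB (B (i + 1)) ψ := fun i => by
    simp only [hvdef, if_neg (Nat.not_even_two_mul_add_one i)]
    rw [show (2 * i + 1) / 2 = i by omega]
  have hv0 : v 0 = leftRep HA HB (A 1) ψ := by
    rw [← next_of_le A (by omega : 1 ≤ n)]; exact hve 0
  have hterm : ∀ i ∈ Finset.range n,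
      ⟪ψ, (tensorOp (A (i + 1)) (B (i + 1)) +
        tensorOp (next n A (i + 1 + 1)) (B (i + 1))) ψ⟫_ℂ =
      ⟪v (2 * i), v (2 * i + 1)⟫_ℂ + ⟪v (2 * i + 2), v (2 * i + 1)⟫_ℂ := fun i hi => by
    rw [Finset.mem_range] at hi
    have h₁ := isObservable_next hn hA (k := i + 1) (Finset.mem_Icc.2 (by omega))
    have h₂ := isObservable_next hn hA (k := i + 1 + 1) (Finset.mem_Icc.2 (by omega))
    rw [show 2 * i + 2 = 2 * (i + 1) from rfl, hve, hve, hvo, inner_map_left _ h₁.1,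
      inner_map_left _ h₂.1, add_apply, inner_add_right, tensorOp_apply_eq, tensorOp_apply_eq,
      next_of_le A (by omega : i + 1 ≤ n)]
  have hbell : ⟪ψ, bellOperator n A B ψ⟫_ℂ = ∑ i ∈ Finset.range n,
      (⟪v (2 * i), v (2 * i + 1)⟫_ℂ + ⟪v (2 * i + 2), v (2 * i + 1)⟫_ℂ) := by
    rw [bellOperator, sum_apply, inner_sum, ← Finset.sum_congr rfl hterm,
      Finset.range_eq_Ico, Finset.sum_Ico_add' (fun i => ⟪ψ, (tensorOp (A i) (B i) +
        tensorOp (next n A (i + 1)) (B i)) ψ⟫_ℂ) 0 n 1]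
    rfl
  have hsum : ∑ k ∈ Finset.range (2 * n), (⟪v k, v (k + 1)⟫_ℂ).re =
      ((2 * n : ℕ) : ℝ) * Real.cos (Real.pi / ((2 * n : ℕ) : ℝ)) := by
    have h := congrArg Complex.re (hbell.symm.trans hmax)
    rw [Complex.ofReal_re, Complex.re_sum] at h
    rw [sum_range_two_mul]
    push_cast
    rw [← h]
    refine Finset.sum_congr rfl fun i _ => ?_
    rw [Complex.add_re]
    congr 1
    -- The term with Aᵢ₊₁ runs against the direction of the chain; only the real part is insensitive
    -- to this.
    exact inner_re_symm (𝕜 := ℂ) _ _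
  have hnorm : ∀ k < 2 * n, ‖v k‖ = 1 := fun k hk => by
    rcases Nat.even_or_odd' k with ⟨i, rfl | rfl⟩
    · rw [hve, (isObservable_next hn hA (Finset.mem_Icc.2 (by omega))).norm_map, hψ]
    · rw [hvo, (hB _ (Finset.mem_Icc.2 (by omega))).norm_map, hψ]
  have hlast : v (2 * n) = -v 0 := by
    rw [hve, hv0, next, if_pos rfl, map_neg]
    rfl
  obtain ⟨f, hf⟩ := planar_of_sum_re_inner_eq (by omega) v hnorm hlast hsum
  refine ⟨f, fun i hi => ?_, fun j hj => ?_⟩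
  · rw [Finset.mem_Icc] at hi
    obtain ⟨k, rfl⟩ : ∃ k, i = k + 1 := ⟨i - 1, by omega⟩
    have h := hf (2 * k) (by omega)
    rw [hve, next_of_le A (by omega), hv0] at h
    rw [h, show ((2 * k : ℕ) : ℝ) * (Real.pi / ((2 * n : ℕ) : ℝ)) =
      (((k + 1 : ℕ) : ℝ) - 1) * Real.pi / n by push_cast; field_simp; ring]
  · rw [Finset.mem_Icc] at hj
    obtain ⟨k, rfl⟩ : ∃ k, j = k + 1 := ⟨j - 1, by omega⟩
    have h := hf (2 * k + 1) (by omega)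
    rw [hvo, hv0] at h
    rw [h, show ((2 * k + 1 : ℕ) : ℝ) * (Real.pi / ((2 * n : ℕ) : ℝ)) =
      (2 * ((k + 1 : ℕ) : ℝ) - 1) * Real.pi / (2 * n) by push_cast; field_simp; ring]

/-- The relations that make the swap circuit extract a maximally entangled pair. -/
structure IsSwapFrame (XA ZA : HA →L[ℂ] HA) (XB ZB : HB →L[ℂ] HB) (ψ : JointSpace HA HB) :
    Prop where
  right_X : rightRep HA HB XB ψ = leftRep HA HB XA ψ
  right_Z : rightRep HA HB ZB ψ = leftRep HA HB ZA ψ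
  X_X : leftRep HA HB XA (leftRep HA HB XA ψ) = ψ
  Z_Z : leftRep HA HB ZA (leftRep HA HB ZA ψ) = ψ
  Z_X : leftRep HA HB ZA (leftRep HA HB XA ψ) = -leftRep HA HB XA (leftRep HA HB ZA ψ)

namespace IsSwapFrame

variable {XA ZA : HA →L[ℂ] HA} {XB ZB : HB →L[ℂ] HB} {ψ : JointSpace HA HB}

/-- Relations known on ψ pass to Zψ by writing Zψ as Bob's operator applied to ψ and pulling that
operator outside. -/
theorem X_X_Z (h : IsSwapFrame XA ZA XB ZB ψ) :
    leftRep HA HB XA (leftRep HA HB XA (leftRep HA HB ZA ψ)) = leftRep HA HB ZA ψ := by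
  rw [← h.right_Z, ← rightRep_leftRep_apply, ← rightRep_leftRep_apply, h.X_X]

theorem Z_X_Z (h : IsSwapFrame XA ZA XB ZB ψ) :
    leftRep HA HB ZA (leftRep HA HB XA (leftRep HA HB ZA ψ)) = -leftRep HA HB XA ψ := by
  rw [← h.right_Z, ← rightRep_leftRep_apply, ← rightRep_leftRep_apply, h.Z_X, map_neg,
    rightRep_leftRep_apply, rightRep_leftRep_apply, h.right_Z, h.Z_Z]

theorem regularization (h : IsSwapFrame XA ZA XB ZB ψ) (hXA : IsSelfAdjoint XA)
    (hZA : IsSelfAdjoint ZA) (hXB : IsSelfAdjoint XB) (hZB : IsSelfAdjoint ZB) :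
    IsSwapFrame (regularization XA) (regularization ZA) (regularization XB) (regularization ZB)
      ψ := by
  have hxA := map_regularization_apply (leftRep HA HB) hXA h.X_X
  have hzA := map_regularization_apply (leftRep HA HB) hZA h.Z_Z
  have hxB := map_regularization_apply (rightRep HA HB) hXB (v := ψ)
    (by rw [h.right_X, rightRep_leftRep_apply, h.right_X, h.X_X])
  have hzB := map_regularization_apply (rightRep HA HB) hZB (v := ψ)
    (by rw [h.right_Z, rightRep_leftRep_apply, h.right_Z, h.Z_Z])
  refine ⟨by rw [hxB, h.right_X, hxA], by rw [hzB, h.right_Z, hzA], ?_, ?_, ?_⟩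
  -- Regularized operators are controlled on ψ only, so before the second application Xψ is
  -- rewritten with Bob's operator and that operator is moved outside.
  · rw [hxA, ← h.right_X, ← rightRep_leftRep_apply, hxA, rightRep_leftRep_apply, h.right_X, h.X_X]
  · rw [hzA, ← h.right_Z, ← rightRep_leftRep_apply, hzA, rightRep_leftRep_apply, h.right_Z, h.Z_Z]
  · rw [hxA, hzA, ← h.right_X, ← h.right_Z, ← rightRep_leftRep_apply, ← rightRep_leftRep_apply,
      hxA, hzA, rightRep_leftRep_apply, rightRep_leftRep_apply, h.right_X, h.right_Z, h.Z_X]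

/-- The value of the swap circuit on the span of `ψ`, `Z ψ`, `X ψ` and `X Z ψ`. -/
theorem circuit_apply (h : IsSwapFrame XA ZA XB ZB ψ) (a b c d : ℂ) :
    (circuitA XA ZA ∘L circuitB XB ZB)
      ((a • ψ + b • leftRep HA HB ZA ψ + c • leftRep HA HB XA ψ +
        d • leftRep HA HB XA (leftRep HA HB ZA ψ)) ⊗ₜ[ℂ] (ket 0 ⊗ₜ[ℂ] ket 0)) =
      ((1 / 2 : ℂ) • (ψ + leftRep HA HB ZA ψ)) ⊗ₜ[ℂ]
        (a • (ket 0 ⊗ₜ[ℂ] ket 0 + ket 1 ⊗ₜ[ℂ] ket 1) +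
          b • (ket 0 ⊗ₜ[ℂ] ket 0 - ket 1 ⊗ₜ[ℂ] ket 1) +
          c • (ket 1 ⊗ₜ[ℂ] ket 0 + ket 0 ⊗ₜ[ℂ] ket 1) +
          d • (ket 1 ⊗ₜ[ℂ] ket 0 - ket 0 ⊗ₜ[ℂ] ket 1)) := by
  rw [ContinuousLinearMap.comp_apply, circuitB_tmul_zero, map_smul, map_add, circuitA_tmul_zero,
    circuitA_tmul_zero]
  -- Bob's operators are moved onto ψ and become Alice's; every word then reduces to a multiple of
  -- ψ, Zψ, Xψ or XZψ.
  simp only [map_add, map_sub, map_smul, map_neg, rightRep_leftRep_apply, h.right_X, h.right_Z,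
    h.X_X, h.Z_Z, h.Z_X, h.X_X_Z, h.Z_X_Z, TensorProduct.add_tmul, TensorProduct.sub_tmul,
    TensorProduct.neg_tmul, ← TensorProduct.smul_tmul', TensorProduct.tmul_add,
    TensorProduct.tmul_sub, TensorProduct.tmul_smul]
  module

end IsSwapFrame

end MaximalViolation

/-! ### The operators X and Z as coordinate directions -/

section Frame

theorem cos_pi_div_two_mul_pos {n : ℕ} (hn : 2 ≤ n) : 0 < Real.cos (Real.pi / (2 * n)) := by
  have h : (2 : ℝ) ≤ n := by exact_mod_cast hn
  refine Real.cos_pos_of_mem_Ioo ⟨?_, ?_⟩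
  · have : 0 < Real.pi / (2 * n) := by positivity
    linarith [Real.pi_pos]
  · exact div_lt_div_of_pos_left Real.pi_pos two_pos (by linarith)

theorem sin_pi_div_two_mul_pos {n : ℕ} (hn : 2 ≤ n) : 0 < Real.sin (Real.pi / (2 * n)) := by
  have h : (2 : ℝ) ≤ n := by exact_mod_cast hn
  refine Real.sin_pos_of_pos_of_lt_pi (by positivity) (div_lt_self Real.pi_pos (by linarith))

theorem scale_mul_two_cos {n : ℕ} (hn : 2 ≤ n) :
    scale n * (2 * ((Real.cos (Real.pi / (2 * n)) : ℝ) : ℂ)) = 1 := by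
  have h := (cos_pi_div_two_mul_pos hn).ne'
  rw [scale, ← Complex.ofReal_ofNat, ← Complex.ofReal_mul, ← Complex.ofReal_mul,
    one_div_mul_cancel (by positivity), Complex.ofReal_one]

theorem isSelfAdjoint_scale (n : ℕ) : IsSelfAdjoint (scale n) := Complex.conj_ofReal _

variable {V : Type*} [AddCommGroup V] [Module ℂ V]

/-- The angles are symmetric about π/2: the e-parts cancel and the f-parts add up to 2 cos(π/2n),
which `scale` inverts. -/
theorem scale_smul_add {n : ℕ} (hn : 2 ≤ n) {s t : ℝ}
    (hs : s = Real.pi / 2 - Real.pi / (2 * n)) (ht : t = Real.pi / 2 + Real.pi / (2 * n))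
    (e f : V) :
    scale n • (((Real.cos s : ℝ) : ℂ) • e + ((Real.sin s : ℝ) : ℂ) • f +
      (((Real.cos t : ℝ) : ℂ) • e + ((Real.sin t : ℝ) : ℂ) • f)) = f := by
  rw [hs, ht, Real.cos_pi_div_two_sub, Real.sin_pi_div_two_sub, add_comm (Real.pi / 2),
    Real.cos_add_pi_div_two, Real.sin_add_pi_div_two]
  conv_rhs => rw [← one_smul ℂ f, ← scale_mul_two_cos hn]
  push_cast
  module

theorem scale_smul_sub {n : ℕ} (hn : 2 ≤ n) {s t : ℝ}
    (hs : s = Real.pi / (2 * n)) (ht : t = Real.pi - Real.pi / (2 * n)) (e f : V) :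
    scale n • (((Real.cos s : ℝ) : ℂ) • e + ((Real.sin s : ℝ) : ℂ) • f -
      (((Real.cos t : ℝ) : ℂ) • e + ((Real.sin t : ℝ) : ℂ) • f)) = e := by
  rw [hs, ht, Real.cos_pi_sub, Real.sin_pi_sub]
  conv_rhs => rw [← one_smul ℂ e, ← scale_mul_two_cos hn]
  push_cast
  module

variable {HA HB : Type*} [NormedAddCommGroup HA] [InnerProductSpace ℂ HA]
  [NormedAddCommGroup HB] [InnerProductSpace ℂ HB] [CompleteSpace HA] [CompleteSpace HB]

theorem isSelfAdjoint_opXA {n : ℕ} (hn : 2 ≤ n) {A : ℕ → HA →L[ℂ] HA}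
    (hA : ∀ i ∈ Finset.Icc 1 n, IsObservable (A i)) : IsSelfAdjoint (opXA n A) := by
  unfold opXA
  split_ifs with h
  · exact (hA _ (Finset.mem_Icc.2 (by omega))).1
  · obtain ⟨m, rfl⟩ := Nat.not_even_iff_odd.1 h
    exact (isSelfAdjoint_scale _).smul ((hA _ (Finset.mem_Icc.2 (by omega))).1.add
      (hA _ (Finset.mem_Icc.2 (by omega))).1)

theorem isSelfAdjoint_opXB {n : ℕ} (hn : 2 ≤ n) {B : ℕ → HB →L[ℂ] HB}
    (hB : ∀ i ∈ Finset.Icc 1 n, IsObservable (B i)) : IsSelfAdjoint (opXB n B) := by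
  unfold opXB
  split_ifs with h
  · exact (isSelfAdjoint_scale _).smul ((hB _ (Finset.mem_Icc.2 (by omega))).1.add
      (hB _ (Finset.mem_Icc.2 (by omega))).1)
  · exact (hB _ (Finset.mem_Icc.2 (by omega))).1

theorem isSelfAdjoint_opZB {n : ℕ} (hn : 2 ≤ n) {B : ℕ → HB →L[ℂ] HB}
    (hB : ∀ i ∈ Finset.Icc 1 n, IsObservable (B i)) : IsSelfAdjoint (opZB n B) :=
  (isSelfAdjoint_scale _).smul ((hB _ (Finset.mem_Icc.2 (by omega))).1.sub
    (hB _ (Finset.mem_Icc.2 (by omega))).1)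

/-- In the plane of the maximal violation the operators `X` and `Z` of both parties act on the
state as the coordinate directions. -/
theorem isSwapFrame_of_planar {n : ℕ} (hn : 2 ≤ n)
    {A : ℕ → HA →L[ℂ] HA} {B : ℕ → HB →L[ℂ] HB}
    (hA : ∀ i ∈ Finset.Icc 1 n, IsObservable (A i))
    (hB : ∀ i ∈ Finset.Icc 1 n, IsObservable (B i))
    {ψ f : JointSpace HA HB}
    (hAf : ∀ i ∈ Finset.Icc 1 n, leftRep HA HB (A i) ψ =
      ((Real.cos (((i : ℝ) - 1) * Real.pi / n) : ℝ) : ℂ) • leftRep HA HB (A 1) ψ +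
        ((Real.sin (((i : ℝ) - 1) * Real.pi / n) : ℝ) : ℂ) • f)
    (hBf : ∀ j ∈ Finset.Icc 1 n, rightRep HA HB (B j) ψ =
      ((Real.cos ((2 * (j : ℝ) - 1) * Real.pi / (2 * n)) : ℝ) : ℂ) • leftRep HA HB (A 1) ψ +
        ((Real.sin ((2 * (j : ℝ) - 1) * Real.pi / (2 * n)) : ℝ) : ℂ) • f) :
    leftRep HA HB (opXA n A) ψ = f ∧
      IsSwapFrame (opXA n A) (opZA A) (opXB n B) (opZB n B) ψ := by
  have hZB : rightRep HA HB (opZB n B) ψ = leftRep HA HB (A 1) ψ := by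
    rw [opZB, map_smul, map_sub, smul_apply, sub_apply, hBf 1 (Finset.mem_Icc.2 (by omega)),
      hBf n (Finset.mem_Icc.2 (by omega))]
    refine scale_smul_sub hn ?_ ?_ _ _
    · norm_num
    · field_simp
  have hXX : leftRep HA HB (opXA n A) ψ = f ∧ rightRep HA HB (opXB n B) ψ = f ∧
      leftRep HA HB (opXA n A) (leftRep HA HB (opXA n A) ψ) = ψ := by
    rcases Nat.even_or_odd' n with ⟨m, rfl | rfl⟩
    -- Even case: an observable of Alice sits exactly at π/2 and two of Bob's lie symmetrically
    -- around it. In the odd case the roles are exchanged.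
    · have hm : 1 ≤ m := by omega
      have hm0 : (m : ℝ) ≠ 0 := by positivity
      have hXA : opXA (2 * m) A = A (m + 1) := by simp [opXA]
      have hXB : opXB (2 * m) B = scale (2 * m) • (B m + B (m + 1)) := by simp [opXB]
      have h₁ := hA (m + 1) (Finset.mem_Icc.2 (by omega))
      refine ⟨?_, ?_, ?_⟩
      · rw [hXA, hAf (m + 1) (Finset.mem_Icc.2 (by omega)),
          show (((m + 1 : ℕ) : ℝ) - 1) * Real.pi / ((2 * m : ℕ) : ℝ) = Real.pi / 2 by
            push_cast; field_simp; ring]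
        simp
      · rw [hXB, map_smul, map_add, smul_apply, add_apply, hBf m (Finset.mem_Icc.2 (by omega)),
          hBf (m + 1) (Finset.mem_Icc.2 (by omega))]
        refine scale_smul_add hn ?_ ?_ _ _
        · push_cast; field_simp
        · push_cast; field_simp; ring
      · rw [hXA, h₁.map_map]
    · have hm : 1 ≤ m := by omega
      have hm0 : 2 * (m : ℝ) + 1 ≠ 0 := by positivity
      have hXA : opXA (2 * m + 1) A = scale (2 * m + 1) • (A (m + 1) + A (m + 2)) := by
        rw [opXA, if_neg (Nat.not_even_two_mul_add_one m), show (2 * m + 1 + 1) / 2 = m + 1 by omega,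
          show (2 * m + 1 + 3) / 2 = m + 2 by omega]
      have hXB : opXB (2 * m + 1) B = B (m + 1) := by
        rw [opXB, if_neg (Nat.not_even_two_mul_add_one m), show (2 * m + 1 + 1) / 2 = m + 1 by omega]
      have h₁ := hB (m + 1) (Finset.mem_Icc.2 (by omega))
      have hf : leftRep HA HB (opXA (2 * m + 1) A) ψ = f := by
        rw [hXA, map_smul, map_add, smul_apply, add_apply,
          hAf (m + 1) (Finset.mem_Icc.2 (by omega)), hAf (m + 2) (Finset.mem_Icc.2 (by omega))]
        refine scale_smul_add hn ?_ ?_ _ _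
        · push_cast; field_simp; ring
        · push_cast; field_simp; ring
      have hf' : rightRep HA HB (opXB (2 * m + 1) B) ψ = f := by
        rw [hXB, hBf (m + 1) (Finset.mem_Icc.2 (by omega)),
          show (2 * ((m + 1 : ℕ) : ℝ) - 1) * Real.pi / (2 * ((2 * m + 1 : ℕ) : ℝ)) =
            Real.pi / 2 by push_cast; field_simp; ring]
        simp
      refine ⟨hf, hf', ?_⟩
      -- Alice's X is here a scaled sum, not a given involution; its square on ψ comes from Bob's
      -- observable, as X_A X_A ψ = X_A X_B ψ = X_B X_A ψ = X_B X_B ψ.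
      rw [hf, ← hf', ← rightRep_leftRep_apply, hf, ← hf', hXB, h₁.map_map]
  obtain ⟨hXA, hXB, hX⟩ := hXX
  have hA₁ := hA 1 (Finset.mem_Icc.2 (by omega))
  have hB₁ := hB 1 (Finset.mem_Icc.2 (by omega))
  have hZ : leftRep HA HB (opZA A) (leftRep HA HB (opZA A) ψ) = ψ := hA₁.map_map _ _
  refine ⟨hXA, by rw [hXB, hXA], hZB, hX, hZ, ?_⟩
  -- B₁ψ = cZψ + sXψ lies strictly between the axes. Expanding B₁²ψ = ψ with X²ψ = Z²ψ = ψ and c² +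
  -- s² = 1 leaves cs(ZX + XZ)ψ = 0, and cs ≠ 0.
  have hb := hBf 1 (Finset.mem_Icc.2 (by omega))
  rw [show (2 * ((1 : ℕ) : ℝ) - 1) * Real.pi / (2 * n) = Real.pi / (2 * n) by norm_num,
    ← hXA] at hb
  change _ = _ • leftRep HA HB (opZA A) ψ + _ at hb
  have hcs : ((Real.cos (Real.pi / (2 * n)) : ℝ) : ℂ) ^ 2 +
      ((Real.sin (Real.pi / (2 * n)) : ℝ) : ℂ) ^ 2 = 1 := by
    exact_mod_cast Real.cos_sq_add_sin_sq _
  have hc0 : ((Real.cos (Real.pi / (2 * n)) : ℝ) : ℂ) ≠ 0 := by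
    exact_mod_cast (cos_pi_div_two_mul_pos hn).ne'
  have hs0 : ((Real.sin (Real.pi / (2 * n)) : ℝ) : ℂ) ≠ 0 := by
    exact_mod_cast (sin_pi_div_two_mul_pos hn).ne'
  generalize ((Real.cos (Real.pi / (2 * n)) : ℝ) : ℂ) = c at hb hcs hc0
  generalize ((Real.sin (Real.pi / (2 * n)) : ℝ) : ℂ) = s at hb hcs hs0
  have h := hB₁.map_map (rightRep HA HB) ψ
  rw [hb] at h
  simp only [map_add, map_smul, rightRep_leftRep_apply, hb, hZ, hX] at h
  have h' : (c * s) • (leftRep HA HB (opZA A) (leftRep HA HB (opXA n A) ψ) +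
      leftRep HA HB (opXA n A) (leftRep HA HB (opZA A) ψ)) = 0 := by
    have h₁ := h.trans (one_smul ℂ ψ).symm
    rw [← hcs, ← sub_eq_zero] at h₁
    refine Eq.trans ?_ h₁
    module
  exact eq_neg_of_add_eq_zero_left ((smul_eq_zero.1 h').resolve_left (mul_ne_zero hc0 hs0))

end Frame

end ChainedBell

end

/-! ### The self-testing theorem -/

theorem theorem1 {HA HB : Type*}
    [NormedAddCommGroup HA] [InnerProductSpace ℂ HA] [CompleteSpace HA]
    [NormedAddCommGroup HB] [InnerProductSpace ℂ HB] [CompleteSpace HB]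
    (n : ℕ) (hn : 2 ≤ n)
    (A : ℕ → HA →L[ℂ] HA) (B : ℕ → HB →L[ℂ] HB)
    (hA : ∀ i ∈ Finset.Icc 1 n, IsObservable (A i))
    (hB : ∀ i ∈ Finset.Icc 1 n, IsObservable (B i))
    (ψ : JointSpace HA HB) (hψ : ‖ψ‖ = 1)
    (hmax : ⟪ψ, bellOperator n A B ψ⟫_ℂ =
      ((2 * n * Real.cos (Real.pi / (2 * n)) : ℝ) : ℂ)) :
    (∃ U : CircuitSpace HA HB ≃ₗᵢ[ℂ] CircuitSpace HA HB, ∀ v, U v = swapCircuit n A B v) ∧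
    ∃ φ : JointSpace HA HB, ‖φ‖ = 1 ∧
      swapCircuit n A B (ψ ⊗ₜ[ℂ] (ket 0 ⊗ₜ[ℂ] ket 0)) = φ ⊗ₜ[ℂ] phiPlus ∧
      (∀ i ∈ Finset.Icc 1 n,
        swapCircuit n A B (tensorOp (A i) 1 ψ ⊗ₜ[ℂ] (ket 0 ⊗ₜ[ℂ] ket 0)) =
          φ ⊗ₜ[ℂ] TensorProduct.mapL (refA n i) 1 phiPlus) ∧
      (∀ j ∈ Finset.Icc 1 n,
        swapCircuit n A B (tensorOp 1 (B j) ψ ⊗ₜ[ℂ] (ket 0 ⊗ₜ[ℂ] ket 0)) =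
          φ ⊗ₜ[ℂ] TensorProduct.mapL 1 (refB n j) phiPlus) ∧
      ∀ i ∈ Finset.Icc 1 n, ∀ j ∈ Finset.Icc 1 n,
        swapCircuit n A B (tensorOp (A i) (B j) ψ ⊗ₜ[ℂ] (ket 0 ⊗ₜ[ℂ] ket 0)) =
          φ ⊗ₜ[ℂ] TensorProduct.mapL (refA n i) (refB n j) phiPlus := by
  obtain ⟨f, hAf, hBf⟩ := exists_planar_of_maximal hn hA hB hψ hmax
  obtain ⟨rfl, hframe⟩ := isSwapFrame_of_planar hn hA hB hAf hBf
  have hXA := isSelfAdjoint_opXA hn hA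
  have hZA : IsSelfAdjoint (opZA A) := (hA 1 (Finset.mem_Icc.2 (by omega))).1
  have hXB := isSelfAdjoint_opXB hn hB
  have hZB := isSelfAdjoint_opZB hn hB
  have hreg := hframe.regularization hXA hZA hXB hZB
  have hX := map_regularization_apply (leftRep HA HB) hXA hframe.X_X
  have hZ := map_regularization_apply (leftRep HA HB) hZA hframe.Z_Z
  have hXZ : leftRep HA HB (regularization (opXA n A))
      (leftRep HA HB (regularization (opZA A)) ψ) =
        leftRep HA HB (opXA n A) (leftRep HA HB (opZA A) ψ) := by
    rw [hZ, ← hframe.right_Z, ← rightRep_leftRep_apply, hX, rightRep_leftRep_apply]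
  obtain ⟨U, hU⟩ : ∃ U : CircuitSpace HA HB ≃ₗᵢ[ℂ] CircuitSpace HA HB,
      ∀ v, U v = swapCircuit n A B v := by
    obtain ⟨S, hS, h₁, h₂⟩ := (isFormallyUnitary_circuitA (HB := HB)
      (isRegularization_regularization hXA).1 (isRegularization_regularization hZA).1).comp
      (isFormallyUnitary_circuitB (HA := HA)
        (isRegularization_regularization hXB).1 (isRegularization_regularization hZB).1)
    exact hS.exists_linearIsometryEquiv h₁ h₂
  have happ := hreg.circuit_apply
  rw [hXZ, hX, hZ] at happ
  change ∀ a b c d : ℂ, swapCircuit n A B _ = _ at happ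
  -- The circuit yields (ψ + Zψ)/2 next to unnormalized Bell vectors; the factor √2 compensates the
  -- 1/√2 in `phiPlus`.
  set φ : JointSpace HA HB :=
    ((√2 : ℝ) : ℂ) • (1 / 2 : ℂ) • (ψ + leftRep HA HB (opZA A) ψ) with hφ
  have hφt : ∀ q : Qubit ⊗[ℂ] Qubit, φ ⊗ₜ[ℂ] (((1 / √2 : ℝ) : ℂ) • q) =
      ((1 / 2 : ℂ) • (ψ + leftRep HA HB (opZA A) ψ)) ⊗ₜ[ℂ] q := fun q => by
    rw [hφ, TensorProduct.smul_tmul_smul, ← Complex.ofReal_mul, mul_one_div_cancel (by positivity),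
      Complex.ofReal_one, one_smul]
  have h₀ : swapCircuit n A B (ψ ⊗ₜ[ℂ] (ket 0 ⊗ₜ[ℂ] ket 0)) = φ ⊗ₜ[ℂ] phiPlus := by
    have h := happ 1 0 0 0
    simp only [one_smul, zero_smul, add_zero] at h
    rw [h, phiPlus, hφt]
  refine ⟨⟨U, hU⟩, φ, ?_, h₀, fun i hi => ?_, fun j hj => ?_, fun i hi j hj => ?_⟩
  -- The norm of φ is read off from the isometry, with no computation of ⟨ψ, Zψ⟩.
  · have h : ‖φ ⊗ₜ[ℂ] phiPlus‖ = ‖ψ ⊗ₜ[ℂ] (ket 0 ⊗ₜ[ℂ] ket 0)‖ := by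
      rw [← h₀, ← hU]
      exact U.norm_map _
    simpa only [TensorProduct.norm_tmul, norm_phiPlus, norm_ket, hψ, mul_one] using h
  · have h := happ 0 (Real.cos (((i : ℝ) - 1) * Real.pi / n) : ℝ)
      (Real.sin (((i : ℝ) - 1) * Real.pi / n) : ℝ) 0
    simp only [zero_smul, add_zero, zero_add] at h
    rw [refA, mapL_planar_one_phiPlus, hφt, ← h]
    exact congrArg (fun v => swapCircuit n A B (v ⊗ₜ[ℂ] (ket 0 ⊗ₜ[ℂ] ket 0))) (hAf i hi)
  · have h := happ 0 (Real.cos ((2 * (j : ℝ) - 1) * Real.pi / (2 * n)) : ℝ)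
      (Real.sin ((2 * (j : ℝ) - 1) * Real.pi / (2 * n)) : ℝ) 0
    simp only [zero_smul, add_zero, zero_add] at h
    rw [refB, mapL_one_planar_phiPlus, hφt, ← h]
    exact congrArg (fun v => swapCircuit n A B (v ⊗ₜ[ℂ] (ket 0 ⊗ₜ[ℂ] ket 0))) (hBf j hj)
  -- By X²ψ = Z²ψ = ψ and ZXψ = −XZψ, the product of two planar observables at angles s and t sends
  -- ψ to cos(s − t)ψ + sin(s − t)XZψ.
  · have h := happ
      (Real.cos (((i : ℝ) - 1) * Real.pi / n - (2 * (j : ℝ) - 1) * Real.pi / (2 * n)) : ℝ) 0 0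
      (Real.sin (((i : ℝ) - 1) * Real.pi / n - (2 * (j : ℝ) - 1) * Real.pi / (2 * n)) : ℝ)
    simp only [zero_smul, add_zero] at h
    rw [refA, refB, mapL_planar_planar_phiPlus, hφt, ← h]
    refine congrArg (fun v => swapCircuit n A B (v ⊗ₜ[ℂ] (ket 0 ⊗ₜ[ℂ] ket 0))) ?_
    have ha := hAf i hi
    have hb := hBf j hj
    change _ = _ • leftRep HA HB (opZA A) ψ + _ at ha hb
    rw [tensorOp_apply_eq, ← rightRep_leftRep_apply, ha, map_add, map_smul, map_smul,
      rightRep_leftRep_apply, rightRep_leftRep_apply, hb]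
    simp only [map_add, map_smul, hframe.X_X, hframe.Z_Z, hframe.Z_X, Real.cos_sub, Real.sin_sub]
    push_cast
    module
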